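/- For a finite connected simple graph $G$ with vertex set $V$ and Laplacian matrix $L(G)=D(G)-A(G)$, the critical group $K(G)$ is the torsion subgroup of $\mathbb Z^{V}/L(G)\mathbb Z^{V}$ (which is isomorphic to $K(G)\oplus\mathbb Z$). Let $C_k$ be the cycle on $k$ vertices and let $C_4\times C_n$ be the Cartesian product graph. Write $(a,b,\dots)$ for the greatest common divisor and $Z_m=\mathbb Z/m\mathbb Z$. For an integer $m\ge 1$ let $\alpha,\beta=\frac{m+2\pm\sqrt{m^2+4m}}{2}$ and $u_k(m)=\frac{\alpha^k-\beta^k}{\alpha-\beta}$ for $k\ge 0$; equivalently, $u_0(m)=0$, $u_1(m)=1$, $u_{k+1}(m)=(m+2)u_k(m)-u_{k-1}(m)$. Put $e_k=u_k(2)$, $f_k=u_k(4)$ (so $e_{k+1}=4e_k-e_{k-1}$ and $f_{k+1}=6f_k-f_{k-1}$), $h_k=e_k+e_{k+1}$ and $g_k=f_k+f_{k+1}$. **Theorem 5.1.** Let $n\ge 3$. (1) If $n=2s+1$ is odd, then $$K(C_4\times C_n)\cong Z_{(n,h_s,g_s)}\oplus Z_{(h_s,g_s)}\oplus Z_{\frac{(n,h_s)(h_s,g_s)}{(n,h_s,g_s)}}\oplus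 Z_{h_s}\oplus Z_{\frac{h_s(nh_s,\,ng_s,\,h_sg_s)}{(n,h_s)(h_s,g_s)}}\oplus Z_{\frac{h_sg_s}{(h_s,g_s)}}\oplus Z_{\frac{4nh_sg_s}{(nh_s,\,ng_s,\,h_sg_s)}}.$$ (2) If $n=2s$ with $s$ odd, then $$K(C_4\times C_n)\cong Z_{(s,e_s,f_s)}\oplus Z_{(e_s,f_s)}\oplus Z_{\frac{(s,e_s)(e_s,f_s)}{(s,e_s,f_s)}}\oplus Z_{e_s}\oplus Z_{\frac{4e_s(se_s,\,sf_s,\,e_sf_s)}{(s,e_s)(e_s,f_s)}}\oplus Z_{\frac{12e_sf_s}{(e_s,f_s)}}\oplus Z_{\frac{48se_sf_s}{(se_s,\,sf_s,\,e_sf_s)}}.$$ (3) If $n=2s$ with $s$ even, then $$K(C_4\times C_n)\cong Z_{(s,e_s,f_s)}\oplus Z_{(e_s,f_s)}\oplus Z_{\frac{4(s,e_s)(e_s,f_s)}{(s,e_s,f_s)}}\oplus Z_{6e_s}\oplus Z_{\frac{6e_s(se_s,\,sf_s,\,e_sf_s)}{(s,e_s)(e_s,f_s)}}\oplus Z_{\frac{2e_sf_s}{(e_s,f_s)}}\oplus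 Z_{\frac{8se_sf_s}{(se_s,\,sf_s,\,e_sf_s)}}.$$ In each case all the fractions are positive integers, and the orders of the seven cyclic factors, in the order in which they are written, form a divisibility chain (each divides the next); that is, this is the invariant factor decomposition of $K(C_4\times C_n)$, with trivial factors $Z_1$ allowed. -/

import Mathlib

open Classical in
/-- The cokernel `ℤ^V / im L(G)` of the Laplacian matrix `L(G) = D(G) - A(G)` of a finite simple
graph `G`, acting on integer vectors. -/
abbrev LaplacianCokernel {V : Type*} [Fintype V] (G : SimpleGraph V) : Type _ :=
  (V → ℤ) ⧸ LinearMap.range (Matrix.mulVecLin (G.lapMatrix ℤ))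

/-- The critical group `K(G)`: the torsion subgroup of `coker L(G)`. For a connected graph,
`coker L(G) ≅ K(G) ⊕ ℤ` with `K(G)` finite. -/
abbrev CriticalGroup {V : Type*} [Fintype V] (G : SimpleGraph V) : Type _ :=
  AddCommGroup.torsion (LaplacianCokernel G)

/-- `A` is isomorphic to `ℤ/t₀ ⊕ ⋯ ⊕ ℤ/tₖ₋₁` with positive `tᵢ` such that each divides the next
one (trivial factors `tᵢ = 1` are allowed). -/
def HasInvariantFactors (A : Type*) [AddCommGroup A] {k : ℕ} (t : Fin k → ℕ) : Prop :=
  (∀ i, 0 < t i) ∧ (∀ i j, i ≤ j → t i ∣ t j) ∧ Nonempty (A ≃+ ((i : Fin k) → ZMod (t i)))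

/-- The sequence `u₀(m) = 0`, `u₁(m) = 1`, `uₖ₊₂(m) = (m + 2) uₖ₊₁(m) - uₖ(m)`. The subtraction of
natural numbers never truncates, see `lucasU_rec`; for the closed form see `lucasU_binet`. -/
def lucasU (m : ℕ) : ℕ → ℕ
  | 0 => 0
  | 1 => 1
  | k + 2 => (m + 2) * lucasU m (k + 1) - lucasU m k

theorem lucasU_le_succ (m k : ℕ) : lucasU m k ≤ lucasU m (k + 1) := by
  induction k with
  | zero => simp [lucasU]
  | succ k ih =>
    have h : lucasU m (k + 2) = (m + 2) * lucasU m (k + 1) - lucasU m k := rfl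
    rw [h, add_mul]
    omega

theorem lucasU_rec (m k : ℕ) :
    (lucasU m (k + 2) : ℤ) = (m + 2) * lucasU m (k + 1) - lucasU m k := by
  have h : lucasU m (k + 2) = (m + 2) * lucasU m (k + 1) - lucasU m k := rfl
  have h1 := lucasU_le_succ m k
  rw [h, Nat.cast_sub (by nlinarith [Nat.zero_le (m * lucasU m (k + 1))])]
  push_cast
  ring

/-- `uₖ(m) = (αᵏ - βᵏ) / (α - β)` with `α, β = (m + 2 ± √(m² + 4m)) / 2`, for `m > 0`. -/
theorem lucasU_binet (m : ℕ) (hm : 0 < m) (α β : ℝ)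
    (hα : α = (m + 2 + Real.sqrt (m ^ 2 + 4 * m)) / 2)
    (hβ : β = (m + 2 - Real.sqrt (m ^ 2 + 4 * m)) / 2) (k : ℕ) :
    (lucasU m k : ℝ) = 1 / (α - β) * (α ^ k - β ^ k) := by
  have hm' : (0 : ℝ) < m := by exact_mod_cast hm
  have hpos : (0 : ℝ) < (m : ℝ) ^ 2 + 4 * m := by positivity
  have hs : Real.sqrt ((m : ℝ) ^ 2 + 4 * m) ^ 2 = (m : ℝ) ^ 2 + 4 * m := Real.sq_sqrt hpos.le
  have hd : α - β ≠ 0 := by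
    have h : α - β = Real.sqrt ((m : ℝ) ^ 2 + 4 * m) := by rw [hα, hβ]; ring
    rw [h]
    exact (Real.sqrt_pos.mpr hpos).ne'
  have ha : α ^ 2 = (m + 2) * α - 1 := by rw [hα]; linear_combination hs / 4
  have hb : β ^ 2 = (m + 2) * β - 1 := by rw [hβ]; linear_combination hs / 4
  induction k using Nat.twoStepInduction with
  | zero => simp [lucasU]
  | one => simp [lucasU, hd]
  | more k ih0 ih1 =>
    have hr : (lucasU m (k + 2) : ℝ) = (m + 2) * lucasU m (k + 1) - lucasU m k := by
      exact_mod_cast lucasU_rec m k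
    rw [hr, ih0, ih1, pow_add α k 2, pow_add β k 2, ha, hb]
    ring

/-- `eₖ = uₖ(2)`: `0, 1, 4, 15, 56, …` -/
def eSeq (k : ℕ) : ℕ := lucasU 2 k

/-- `fₖ = uₖ(4)`: `0, 1, 6, 35, 204, …` -/
def fSeq (k : ℕ) : ℕ := lucasU 4 k

/-- `hₖ = eₖ + eₖ₊₁` -/
def hSeq (k : ℕ) : ℕ := eSeq k + eSeq (k + 1)

/-- `gₖ = fₖ + fₖ₊₁` -/
def gSeq (k : ℕ) : ℕ := fSeq k + fSeq (k + 1)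

/-- The greatest common divisor `(a, b, c)`. -/
def gcd3 (a b c : ℕ) : ℕ := Nat.gcd a (Nat.gcd b c)

/-! Let `M = ℤ[y]/(y⁴ - 1)` be the group ring of `C₄`, `w = y + y⁻¹`, `T = 4 - w`. The vertex `(i,
k)` stands for `yⁱ xᵏ`, and the Laplacian relations say `x² = T x - 1`, so two consecutive layers
determine all others. Hence the cokernel of the Laplacian is the cokernel of `Xⁿ - 1` on `M ⊕ x M`,
where `X` is multiplication by `x` (`nonempty_laplacianCokernel_addEquiv`). The reflection `J : yⁱ ↦
y¹⁻ⁱ` commutes with `w`, and `M` is free over `ℤ[J] = ℤ√1` on `q = 1` and `k = 1 - y²`; so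
everything becomes a 4 × 4 matrix over `ℤ[J]`.

Since `T = X + X⁻¹`, the matrix `Xⁿ - 1` is, up to a power of the unit `X`, `(uₛ(T) + uₛ₊₁(T)) (X -
1)` for `n = 2s + 1` and `uₛ(T) (X² - 1)` for `n = 2s`. On `k` the operator `T` is 4, giving `e`; on
`q`, modulo `k`, it is `4 - 2J`, which is 2 at `J = 1` and 6 at `J = -1`, giving `s` and `f`.
Explicit invertible matrices diagonalize the products over `ℤ[J]`. Reading the diagonal over `ℤ`
gives seven cyclic groups and one copy of `ℤ`: orders `h, h, h, h, n, g, 4g` for odd `n`; `e, e,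
12e, 12e, s, f, 16f` for odd `s`; `2e, 2e, 6e, 6e, s, f, 16f` for even `s`.

Replacing pairs `ℤ/a ⊕ ℤ/b` by gcd and lcm (`nonempty_pi_zmod_addEquiv_of_gcd`) produces the
divisibility chain. The constants land correctly because of the 2-adic and 3-adic valuations of `s`,
`eₛ`, `fₛ`, which come from duplication and triplication formulas for powers of `2 + √3` and `3 +
√8`. -/

/-! ### Equivalent matrices and their cokernels. -/

/-- Two square matrices are equivalent if they differ by invertible factors on both sides. -/
def MatrixEquiv {R m : Type*} [CommRing R] [Fintype m] [DecidableEq m] (A B : Matrix m m R) :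
    Prop :=
  ∃ P Q : Matrix m m R, IsUnit P ∧ IsUnit Q ∧ P * A = B * Q

namespace MatrixEquiv

variable {R m : Type*} [CommRing R] [Fintype m] [DecidableEq m] {A B C : Matrix m m R}

theorem of_mul_eq {P P' Q Q' : Matrix m m R} (hP : P * P' = 1) (hQ : Q * Q' = 1)
    (h : P * A = B * Q) : MatrixEquiv A B :=
  ⟨P, Q, .of_mul_eq_one _ hP, .of_mul_eq_one _ hQ, h⟩

theorem unit_mul {P : Matrix m m R} (hP : IsUnit P) : MatrixEquiv (P * A) A := by
  obtain ⟨u, rfl⟩ := hP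
  exact ⟨↑u⁻¹, 1, u⁻¹.isUnit, isUnit_one, by simp [← mul_assoc]⟩

theorem trans (h₁ : MatrixEquiv A B) (h₂ : MatrixEquiv B C) : MatrixEquiv A C := by
  obtain ⟨P, Q, hP, hQ, h⟩ := h₁
  obtain ⟨P', Q', hP', hQ', h'⟩ := h₂
  exact ⟨P' * P, Q' * Q, hP'.mul hP, hQ'.mul hQ, by rw [mul_assoc, h, ← mul_assoc, h', mul_assoc]⟩

/-- Equivalent matrices have isomorphic cokernels. -/
theorem nonempty_quotient_equiv (h : MatrixEquiv A B) :
    Nonempty (((m → R) ⧸ LinearMap.range A.mulVecLin) ≃ₗ[R]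
      ((m → R) ⧸ LinearMap.range B.mulVecLin)) := by
  obtain ⟨P, Q, ⟨p, rfl⟩, ⟨q, rfl⟩, h⟩ := h
  let f : (m → R) ≃ₗ[R] (m → R) := LinearEquiv.ofLinearMap (Matrix.mulVecLin p)
    (Matrix.mulVecLin (p⁻¹ : (Matrix m m R)ˣ).val)
    (by rw [← Matrix.mulVecLin_mul]; simp) (by rw [← Matrix.mulVecLin_mul]; simp)
  refine ⟨Submodule.Quotient.equiv _ _ f ?_⟩
  ext v
  simp only [Submodule.mem_map, LinearMap.mem_range, Matrix.mulVecLin_apply]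
  constructor
  · rintro ⟨_, ⟨x, rfl⟩, rfl⟩
    refine ⟨q.val.mulVec x, ?_⟩
    change _ = p.val.mulVec _
    simp [h]
  · rintro ⟨x, rfl⟩
    refine ⟨_, ⟨(q⁻¹ : (Matrix m m R)ˣ).val.mulVec x, rfl⟩, ?_⟩
    change p.val.mulVec _ = _
    simp [Matrix.mulVec_mulVec, ← mul_assoc, h]

end MatrixEquiv

/-! ### Explicit diagonalization over a ring with an involution `J`. -/

section Diagonalization

variable {R : Type*} [CommRing R]

/-- Multiplication by `x` on `M[x] / (x² - T x + 1)`, where `T = 4 - w` and `w` acts on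
`M = ℤ[C₄] = R q ⊕ R k`, for `R = ℤ[J]`, by `w q = 2 J q - J k` and `w k = 0`. The basis is
`q, k, x q, x k`. -/
def shiftMatrix (J : R) : Matrix (Fin 4) (Fin 4) R :=
  !![0, 0, -1, 0; 0, 0, 0, -1; 1, 0, 4 - 2 * J, 0; 0, 1, J, 4]

/-- The endomorphism `q ↦ F q + B k`, `k ↦ e k` of `M`, extended to `M ⊕ x M`. -/
def blockMatrix (F B e : R) : Matrix (Fin 4) (Fin 4) R :=
  !![F, 0, 0, 0; B, e, 0, 0; 0, 0, F, 0; 0, 0, B, e]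

theorem shiftMatrix_sub_one (J : R) :
    shiftMatrix J - 1 = !![-1, 0, -1, 0; 0, -1, 0, -1; 1, 0, 3 - 2 * J, 0; 0, 1, J, 3] := by
  ext a b
  fin_cases a <;> fin_cases b <;> simp [shiftMatrix] <;> ring

theorem shiftMatrix_sq_sub_one {J : R} (hJ : J * J = 1) :
    shiftMatrix J ^ 2 - 1 =
      !![-2, 0, -4 + 2 * J, 0; 0, -2, -J, -4; 4 - 2 * J, 0, 18 - 16 * J, 0;
        J, 4, 8 * J - 2, 14] := by
  ext a b
  fin_cases a <;> fin_cases b <;>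
    simp [shiftMatrix, pow_two] <;> grind

/-- The shape `F = e + 2ρ`, `B = -ρ` encodes `F + 2B = e`, and `e = 2j + 1` supplies the Bézout
relation `e - 2j = 1`. With it the transforming matrices have entries polynomial in `J`, `j`, `ρ`;
they are given with their inverses, and everything is a polynomial identity modulo `J² = 1`. -/
theorem matrixEquiv_mul_shiftMatrix_sub_one {J : R} (hJ : J * J = 1) (j ρ : R) :
    MatrixEquiv (blockMatrix (2 * j + 1 + 2 * ρ) (-ρ) (2 * j + 1) * (shiftMatrix J - 1))
      (Matrix.diagonal ![2 * j + 1, 2 * j + 1, 2 * j + 1 + 2 * ρ,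
        4 * (2 * j + 1 + 2 * ρ) * (1 - J)]) := by
  rw [shiftMatrix_sub_one]
  refine .of_mul_eq (P := !![0, 0, -j, 1;
      -J*j, J, -J*j, J;
      0, 0, 1, 0;
      1 - 2*j - 4*j*ρ - 4*j^2 + 2*J*j + 4*J*j*ρ + 4*J*j^2, 2 + 4*ρ + 4*j - 2*J - 4*J*ρ - 4*J*j, 1 -
          2*j - 4*j*ρ - 4*j^2 + 2*J*j + 4*J*j*ρ + 4*J*j^2, 2 + 4*ρ + 4*j - 2*J - 4*J*ρ - 4*J*j])
    (P' := !![0, 2 + 4*ρ + 4*j - 2*J - 4*J*ρ - 4*J*j, -1, 1;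
      -1, 2*j + 4*j*ρ + 4*j^2 + J - 2*J*j - 4*J*j*ρ - 4*J*j^2, -j, j;
      0, 0, 1, 0;
      1, 0, j, 0])
    (Q := !![-ρ - j, 1, -3*ρ - 3*j + J + 2*J*ρ + 2*J*j, 3;
      0, 0, 1 + 2*ρ + 2*j - 2*J*ρ - 2*J*j, 2*J;
      1, 0, 3 - 2*J, 0;
      0, 0, -ρ - 2*j - 2*j*ρ - 2*j^2 + J*ρ + J*j + 2*J*j*ρ + 2*J*j^2, 1 - 2*J*j])
    (Q' := !![0, -3 - 4*j + 2*J + 6*J*j, 1, -4 + 6*J;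
      1, -3*ρ - 4*j - 6*j*ρ - 6*j^2 - J + 3*J*ρ + 3*J*j + 6*J*j*ρ + 6*J*j^2, ρ + j, -1 - 6*ρ - 6*j
          + 6*J*ρ + 6*J*j;
      0, 1 - 2*J*j, 0, -2*J;
      0, ρ + 2*j + 2*j*ρ + 2*j^2 - J*ρ - J*j - 2*J*j*ρ - 2*J*j^2, 0, 1 + 2*ρ + 2*j - 2*J*ρ -
          2*J*j]) ?_ ?_ ?_
  all_goals
    ext a b
    fin_cases a <;> fin_cases b <;>
      simp [blockMatrix, Matrix.mul_apply, Fin.sum_univ_four] <;> grind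

/-- In 2 × 2 blocks, `X² - 1 = [[-2, -T], [T, T² - 2]]`. Subtracting the second block row from the
first and factoring out `[[1, T - 1], [1, T]]` on the right leaves the triangular `[[-(T + 2), 0],
[2, T - 2]]`. The row operation has scalar blocks, so it commutes with every `blockMatrix`. -/
theorem matrixEquiv_mul_shiftMatrix_sq_sub_one {J : R} (hJ : J * J = 1) (F B e : R) :
    MatrixEquiv (blockMatrix F B e * (shiftMatrix J ^ 2 - 1))
      (blockMatrix F B e *
        !![2 * J - 6, 0, 0, 0; -J, -6, 0, 0; 2, 0, 2 - 2 * J, 0; 0, 2, J, 2]) := by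
  rw [shiftMatrix_sq_sub_one hJ]
  refine .of_mul_eq (P := !![1, 0, -1, 0;
      0, 1, 0, -1;
      0, 0, 1, 0;
      0, 0, 0, 1])
    (P' := !![1, 0, 1, 0;
      0, 1, 0, 1;
      0, 0, 1, 0;
      0, 0, 0, 1])
    (Q := !![1, 0, 3 - 2*J, 0;
      0, 1, J, 3;
      1, 0, 4 - 2*J, 0;
      0, 1, J, 4])
    (Q' := !![4 - 2*J, 0, -3 + 2*J, 0;
      J, 4, -J, -3;
      -1, 0, 1, 0;
      0, -1, 0, 1]) ?_ ?_ ?_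
  all_goals
    ext a b
    fin_cases a <;> fin_cases b <;>
      simp [blockMatrix, Matrix.mul_apply, Fin.sum_univ_four] <;> grind

set_option maxHeartbeats 2000000 in
theorem matrixEquiv_mul_shiftMatrix_sq_sub_one_of_odd {J : R} (hJ : J * J = 1) (j ρ : R) :
    MatrixEquiv (blockMatrix (2 * j + 1 + 2 * ρ) (-ρ) (2 * j + 1) * (shiftMatrix J ^ 2 - 1))
      (Matrix.diagonal ![2 * j + 1, 12 * (2 * j + 1), 2 * j + 1 + 2 * ρ,
        16 * (2 * j + 1 + 2 * ρ) * (1 - J)]) := by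
  refine (matrixEquiv_mul_shiftMatrix_sq_sub_one hJ _ _ _).trans ?_
  refine .of_mul_eq (P := !![0, 0, -J*j, J;
      -1 - 2*j - 2*J*j, 2*J, -2 + 2*j + 12*j*ρ + 24*j^2 + 24*j^2*ρ + 24*j^3 + J - 4*J*j - 12*J*j*ρ
          - 24*J*j^2 - 24*J*j^2*ρ - 24*J*j^3, -6 - 12*ρ - 24*j - 24*j*ρ - 24*j^2 + 6*J + 12*J*ρ +
          24*J*j + 24*J*j*ρ + 24*J*j^2;
      J*j + 2*J*j*ρ + 2*J*j^2, -J - 2*J*ρ - 2*J*j, -ρ - 2*j + 4*j*ρ^2 + 2*j^2 + 16*j^2*ρ +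
          8*j^2*ρ^2 + 12*j^3 + 16*j^3*ρ + 8*j^4 - 2*J*j*ρ - 4*J*j*ρ^2 - 4*J*j^2 - 16*J*j^2*ρ -
          8*J*j^2*ρ^2 - 12*J*j^3 - 16*J*j^3*ρ - 8*J*j^4, -2*ρ - 4*ρ^2 - 4*j - 16*j*ρ - 8*j*ρ^2 -
          12*j^2 - 16*j^2*ρ - 8*j^3 + 2*J*ρ + 4*J*ρ^2 + 4*J*j + 16*J*j*ρ + 8*J*j*ρ^2 + 12*J*j^2 +
          16*J*j^2*ρ + 8*J*j^3;
      1, 0, 3 - 8*j - 16*j*ρ - 16*j^2 - J + 8*J*j + 16*J*j*ρ + 16*J*j^2, 8 + 16*ρ + 16*j - 8*J -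
          16*J*ρ - 16*J*j])
    (P' := !![0, -3 - 6*ρ - 6*j + J + 2*J*ρ + 2*J*j, -6 + 2*J, -2 - 6*ρ - 12*j - 12*j*ρ - 12*j^2 +
        J + 2*J*ρ + 4*J*j + 4*J*j*ρ + 4*J*j^2;
      0, -3*j - 6*j*ρ - 6*j^2 - J*ρ - J*j, -6*j - J, -2*j - 6*j*ρ - 12*j^2 - 12*j^2*ρ - 12*j^3 -
          J*ρ - J*j - 2*J*j*ρ - 2*J*j^2;
      2 + 4*ρ + 4*j - 2*J - 4*J*ρ - 4*J*j, 1 + 2*ρ + 2*j, 2, 1 + 2*ρ + 4*j + 4*j*ρ + 4*j^2;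
      2*j + 4*j*ρ + 4*j^2 + J - 2*J*j - 4*J*j*ρ - 4*J*j^2, j + 2*j*ρ + 2*j^2, 2*j, j + 2*j*ρ +
          4*j^2 + 4*j^2*ρ + 4*j^3])
    (Q := !![-2*J*ρ - 2*J*j, 2*J, 1 + 2*ρ + 2*j - 2*J*ρ - 2*J*j, 2*J;
      ρ + 2*ρ^2 + j + 6*j*ρ + 4*j*ρ^2 + 4*j^2 + 8*j^2*ρ + 4*j^3 - 2*J*ρ^2 - 6*J*j*ρ - 4*J*j*ρ^2 -
          4*J*j^2 - 8*J*j^2*ρ - 4*J*j^3, -1 - 2*ρ - 4*j - 4*j*ρ - 4*j^2 + 2*J*ρ + 4*J*j + 4*J*j*ρ +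
          4*J*j^2, 2*ρ + 4*ρ^2 + 3*j + 14*j*ρ + 8*j*ρ^2 + 10*j^2 + 16*j^2*ρ + 8*j^3 - 2*J*ρ -
          4*J*ρ^2 - 3*J*j - 14*J*j*ρ - 8*J*j*ρ^2 - 10*J*j^2 - 16*J*j^2*ρ - 8*J*j^3, -1 - 2*ρ - 4*j
          - 4*j*ρ - 4*j^2 + J + 2*J*ρ + 4*J*j + 4*J*j*ρ + 4*J*j^2;
      1 + 4*ρ^2 + 12*j*ρ + 16*j*ρ^2 + 8*j^2 + 40*j^2*ρ + 16*j^2*ρ^2 + 24*j^3 + 32*j^3*ρ + 16*j^4 -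
          6*J*ρ - 4*J*ρ^2 - 6*J*j - 24*J*j*ρ - 16*J*j*ρ^2 - 20*J*j^2 - 40*J*j^2*ρ - 16*J*j^2*ρ^2 -
          24*J*j^3 - 32*J*j^3*ρ - 16*J*j^4, -4*ρ - 8*j - 16*j*ρ - 24*j^2 - 16*j^2*ρ - 16*j^3 + 6*J
          + 4*J*ρ + 20*J*j + 16*J*j*ρ + 24*J*j^2 + 16*J*j^2*ρ + 16*J*j^3, 8*ρ^2 + 28*j*ρ + 32*j*ρ^2
          + 24*j^2 + 88*j^2*ρ + 32*j^2*ρ^2 + 56*j^3 + 64*j^3*ρ + 32*j^4 - 8*J*ρ^2 - 28*J*j*ρ -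
          32*J*j*ρ^2 - 24*J*j^2 - 88*J*j^2*ρ - 32*J*j^2*ρ^2 - 56*J*j^3 - 64*J*j^3*ρ - 32*J*j^4,
          -4*ρ - 8*j - 16*j*ρ - 24*j^2 - 16*j^2*ρ - 16*j^3 + 4*J*ρ + 8*J*j + 16*J*j*ρ + 24*J*j^2 +
          16*J*j^2*ρ + 16*J*j^3;
      -ρ - j + 2*J*j*ρ + 2*J*j^2, 1 - 2*J*j, -ρ - 2*j - 2*j*ρ - 2*j^2 + J*ρ + J*j + 2*J*j*ρ +
          2*J*j^2, 1 - 2*J*j])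
    (Q' := !![0, 6 + 12*j, 1, 6 + 16*ρ + 32*j + 32*j*ρ + 32*j^2 - 6*J - 16*J*ρ - 32*J*j - 32*J*j*ρ
        - 32*J*j^2;
      0, 6*ρ + 6*j + 12*j*ρ + 12*j^2 - J, ρ + j, 1 + 8*ρ + 16*ρ^2 + 8*j + 48*j*ρ + 32*j*ρ^2 +
          32*j^2 + 64*j^2*ρ + 32*j^3 - J - 8*J*ρ - 16*J*ρ^2 - 8*J*j - 48*J*j*ρ - 32*J*j*ρ^2 -
          32*J*j^2 - 64*J*j^2*ρ - 32*J*j^3;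
      1 - 2*J*j, 0, 0, -2*J;
      ρ + 2*j + 2*j*ρ + 2*j^2 - J*ρ - J*j - 2*J*j*ρ - 2*J*j^2, J, 0, J]) ?_ ?_ ?_
  all_goals
    ext a b
    fin_cases a <;> fin_cases b <;>
      simp [blockMatrix, Matrix.mul_apply, Fin.sum_univ_four] <;> grind

-- Here `e` and `F` share a factor 2, so the common part `d` is split off first. What remains of `F
-- / (2d)` is congruent to `J`, not to 1, modulo 2; the second entry `B` is again forced by `F + 2B
-- = e`.
set_option maxHeartbeats 2000000 in
theorem matrixEquiv_mul_shiftMatrix_sq_sub_one_of_even {J : R} (hJ : J * J = 1) (d j ρ : R) :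
    MatrixEquiv (blockMatrix (d * (2 * (J + 2 * ρ))) (d * (2 * (2 * j + 1) - (J + 2 * ρ)))
        (d * (4 * (2 * j + 1))) * (shiftMatrix J ^ 2 - 1))
      (Matrix.diagonal ![2 * d * (4 * (2 * j + 1)), 2 * d * (12 * (2 * j + 1)), 2 * d * (J + 2 * ρ),
        2 * d * (16 * (J + 2 * ρ) * (1 - J))]) := by
  refine (matrixEquiv_mul_shiftMatrix_sq_sub_one hJ _ _ _).trans ?_
  refine .of_mul_eq (P := !![0, 0, -2 - 4*j + J, 2*J;
      2 + 3*j, 1, 6 + 18*ρ + 9*j + 60*j*ρ + 48*j^2*ρ + 3*J - 18*J*ρ + 21*J*j - 60*J*j*ρ + 24*J*j^2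
          - 48*J*j^2*ρ, -3 + 12*ρ - 12*j + 24*j*ρ - 3*J - 12*J*ρ - 24*J*j*ρ;
      0, 0, 2*ρ + 4*j*ρ + J - J*ρ + 2*J*j, -1 - 2*J*ρ;
      1, 0, -3 + 12*ρ - 8*j + 16*j*ρ + 5*J - 12*J*ρ + 8*J*j - 16*J*j*ρ, -4 + 8*ρ + 4*J - 8*J*ρ])
    (P' := !![-1 - 2*ρ - J - 2*J*ρ, 0, -6 + 2*J, 1;
      2 + ρ - J - 5*J*ρ - 12*J*j*ρ, 1, 3 - 7*J - 12*J*j, -2 - 3*j;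
      2*ρ + J, 0, 2, 0;
      1 - ρ + 2*j + 2*J*ρ + 4*J*j*ρ, 0, -1 + 2*J + 4*J*j, 0])
    (Q := !![-2*ρ, 2*J, 1 - 2*ρ + 2*J*ρ, 2*J;
      ρ + 4*ρ^2 + 8*j*ρ^2 + 2*J*ρ - 4*J*ρ^2 + 4*J*j*ρ - 8*J*j*ρ^2, -2 + 4*ρ - 4*j + 8*j*ρ - J -
          4*J*ρ - 8*J*j*ρ, -1 - ρ + 8*ρ^2 - 8*j*ρ + 16*j*ρ^2 + J*ρ - 8*J*ρ^2 - 2*J*j + 8*J*j*ρ -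
          16*J*j*ρ^2, -1 + 4*ρ - 4*j + 8*j*ρ - J - 4*J*ρ - 8*J*j*ρ;
      1 + 4*ρ + 8*j*ρ, -4*J - 8*J*j, -1 + 4*ρ - 4*j + 8*j*ρ - J - 4*J*ρ - 8*J*j*ρ, -4*J - 8*J*j;
      2*j*ρ - J*ρ, 1 - 2*J*j, ρ - j + 2*j*ρ - J*ρ - 2*J*j*ρ, 1 - 2*J*j])
    (Q' := !![1 + 2*j + J + 2*J*j, 0, 1, -2 + 2*J;
      -1 - j + 2*J*ρ - J*j + 4*J*j*ρ, -1, J*ρ, -1 + 4*ρ + J - 4*J*ρ;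
      1 - 2*J*j, 0, 0, -2*J;
      1 + 2*j + J*j, 1, 0, 2 - 4*ρ - J + 4*J*ρ]) ?_ ?_ ?_
  all_goals
    ext a b
    fin_cases a <;> fin_cases b <;>
      simp [blockMatrix, Matrix.mul_apply, Fin.sum_univ_four] <;> grind

end Diagonalization

/-! ### Factoring `Xⁿ - 1` through Lucas polynomials in `T = X + X⁻¹`. -/

section Powers

variable {E : Type*} [Ring E] {X T : E} {U : ℕ → E}

/-- This is `uₖ₊₁(X + X⁻¹) = Xᵏ + Xᵏ⁻² + ⋯ + X⁻ᵏ` cleared of denominators; the relation `hT`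
replaces invertibility. -/
theorem pow_mul_eq_geom_sum (hT : X * T = X ^ 2 + 1) (h0 : U 0 = 0) (h1 : U 1 = 1)
    (hU : ∀ k, U (k + 2) = T * U (k + 1) - U k) (k : ℕ) :
    X ^ k * U (k + 1) = ∑ i ∈ Finset.range (k + 1), (X ^ 2) ^ i := by
  have step (k : ℕ) : X ^ (k + 1) * U (k + 2) =
      (X ^ 2 + 1) * (X ^ k * U (k + 1)) - X ^ (k + 1) * U k := by
    rw [hU, mul_sub, ← mul_assoc, pow_succ X k, mul_assoc (X ^ k), hT, mul_add, mul_one, add_mul,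
      ← pow_add, add_comm k, pow_add]
    simp only [add_mul, one_mul, mul_assoc]
  induction k using Nat.twoStepInduction with
  | zero => simp [h1]
  | one => rw [step 0]; simp [h0, h1, Finset.sum_range_succ, add_comm]
  | more k ih0 ih1 =>
    have h2 : X ^ (k + 1 + 1) * U (k + 1) = X ^ 2 * (X ^ k * U (k + 1)) := by
      rw [← mul_assoc, ← pow_add]; congr 2; ring
    have h3 : (X ^ 2) ^ (k + 1 + 1) = X ^ 2 * (X ^ 2) ^ (k + 1) := pow_succ' _ _
    rw [step, ih1, h2, ih0, Finset.sum_range_succ _ (k + 1 + 1), Finset.sum_range_succ _ (k + 1),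
        h3]
    noncomm_ring

theorem pow_mul_mul_sq_sub_one (hT : X * T = X ^ 2 + 1) (h0 : U 0 = 0) (h1 : U 1 = 1)
    (hU : ∀ k, U (k + 2) = T * U (k + 1) - U k) (k : ℕ) :
    X ^ k * (U (k + 1) * (X ^ 2 - 1)) = X ^ (2 * (k + 1)) - 1 := by
  rw [← mul_assoc, pow_mul_eq_geom_sum hT h0 h1 hU, geom_sum_mul, ← pow_mul]

/-- In the geometric sum up to `X²ˢ`, `uₛ₊₁` contributes the even powers of `X` and `uₛ` the odd
ones. -/
theorem pow_mul_mul_sub_one (hT : X * T = X ^ 2 + 1) (h0 : U 0 = 0) (h1 : U 1 = 1)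
    (hU : ∀ k, U (k + 2) = T * U (k + 1) - U k) (s : ℕ) :
    X ^ s * ((U s + U (s + 1)) * (X - 1)) = X ^ (2 * s + 1) - 1 := by
  have h : X ^ s * U s = X * ∑ i ∈ Finset.range s, (X ^ 2) ^ i := by
    cases s with
    | zero => simp [h0]
    | succ k => rw [pow_succ', mul_assoc, pow_mul_eq_geom_sum hT h0 h1 hU]
  have h2 (s : ℕ) : X * ∑ i ∈ Finset.range s, (X ^ 2) ^ i +
      ∑ i ∈ Finset.range (s + 1), (X ^ 2) ^ i = ∑ i ∈ Finset.range (2 * s + 1), X ^ i := by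
    induction s with
    | zero => simp
    | succ s ih =>
      rw [Finset.sum_range_succ _ s, Finset.sum_range_succ _ (s + 1), mul_add,
        show 2 * (s + 1) + 1 = 2 * s + 1 + 1 + 1 by ring, Finset.sum_range_succ _ (2 * s + 1 + 1),
        Finset.sum_range_succ _ (2 * s + 1), ← ih, ← pow_mul, ← pow_mul, ← pow_succ']
      simp only [show 2 * (s + 1) = 2 * s + 1 + 1 by ring]
      abel
  rw [← mul_assoc, mul_add, h, pow_mul_eq_geom_sum hT h0 h1 hU, h2, geom_sum_mul]

end Powers

/-! ### Cokernels of diagonal matrices over `ℤ[J]`, read over `ℤ`. -/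

theorem nonempty_torsion_addEquiv {A B : Type*} [AddCommGroup A] [AddCommGroup B] [Finite B]
    (ψ : A ≃+ B × ℤ) : Nonempty (AddCommGroup.torsion A ≃+ B) := by
  let f : AddCommGroup.torsion A →+ B :=
    (AddMonoidHom.fst B ℤ).comp (ψ.toAddMonoidHom.comp (AddCommGroup.torsion A).subtype)
  refine ⟨AddEquiv.ofBijective f ⟨?_, ?_⟩⟩
  · rw [injective_iff_map_eq_zero]
    rintro ⟨a, ha⟩ h
    have h1 : (ψ a).1 = 0 := h
    have h2 : (ψ a).2 = 0 := by
      obtain ⟨n, hn, h⟩ := isOfFinAddOrder_iff_nsmul_eq_zero.1 ha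
      have : n • ψ a = 0 := by rw [← map_nsmul, h, map_zero]
      have := congrArg Prod.snd this
      simpa [hn.ne'] using this
    have : a = 0 := ψ.injective (by rw [map_zero]; exact Prod.ext h1 h2)
    exact Subtype.ext this
  · intro b
    refine ⟨⟨ψ.symm (b, 0), ?_⟩, by simp [f]⟩
    change IsOfFinAddOrder _
    obtain ⟨n, hn, h⟩ := isOfFinAddOrder_iff_nsmul_eq_zero.1 (isOfFinAddOrder_of_finite b)
    refine isOfFinAddOrder_iff_nsmul_eq_zero.2 ⟨n, hn, ?_⟩
    rw [← map_nsmul, Prod.smul_mk, h, smul_zero]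
    exact map_zero _

/-- The functionals on `ℤ√1 ^ 4` whose values modulo the invariants of a diagonal matrix describe
the cokernel of this matrix. -/
def diagonalCoord (α : ℤ) (v : Fin 4 → ℤ√1) : Fin 7 → ℤ :=
  ![(v 0).re, (v 0).im, (v 1).re, (v 1).im, (v 2).re + (v 2).im,
    α * (v 2).re + (α + 1) * (v 2).im, (v 3).re]

theorem diagonalCoord_zero (α : ℤ) (i : Fin 7) : diagonalCoord α 0 i = 0 := by
  fin_cases i <;> simp [diagonalCoord]

theorem diagonalCoord_add (α : ℤ) (v w : Fin 4 → ℤ√1) (i : Fin 7) :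
    diagonalCoord α (v + w) i = diagonalCoord α v i + diagonalCoord α w i := by
  fin_cases i <;> simp [diagonalCoord] <;> ring

/-- An integer `a` contributes `(ℤ/a)²`. Multiplication by `F` has determinant `(F.re + F.im)(F.re -
F.im)` over `ℤ`; as `F.re - F.im = 2α + 1` is odd, the unimodular functionals `(1, 1)` and `(α, α +
1)` split its cokernel, also after scaling by `k`. The ideal of `c (1 - J)` is spanned over `ℤ` by
that single element, which leaves `ℤ/c` and the free summand. -/
theorem nonempty_diagonal_quotient_addEquiv (a b c s f : ℕ) (k α : ℤ) (F : ℤ√1)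
    (hα : F.re - F.im = 2 * α + 1) (hs : (s : ℤ) = k * (F.re + F.im))
    (hf : (f : ℤ) = k * (F.re - F.im)) :
    Nonempty (((Fin 4 → ℤ√1) ⧸ LinearMap.range (Matrix.mulVecLin (Matrix.diagonal
        ![(a : ℤ√1), (b : ℤ√1), (k : ℤ√1) * F, (c : ℤ√1) * (1 - Zsqrtd.sqrtd)]))) ≃+
      ((i : Fin 7) → ZMod (![a, a, b, b, s, f, c] i)) × ℤ) := by
  set D := Matrix.diagonal
    ![(a : ℤ√1), (b : ℤ√1), (k : ℤ√1) * F, (c : ℤ√1) * (1 - Zsqrtd.sqrtd)] with hD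
  let φ : (Fin 4 → ℤ√1) →+ ((i : Fin 7) → ZMod (![a, a, b, b, s, f, c] i)) × ℤ :=
    { toFun := fun v => (fun i => (diagonalCoord α v i : ZMod _), (v 3).re + (v 3).im)
      map_zero' := by
        refine Prod.ext (funext fun i => ?_) (by simp)
        simp [diagonalCoord_zero]
      map_add' := fun v w => by
        refine Prod.ext (funext fun i => ?_) (by simp; ring)
        simp [diagonalCoord_add] }
  have hsurj : Function.Surjective φ := by
    rintro ⟨y, m⟩
    choose z hz using fun i => ZMod.intCast_surjective (y i)
    refine ⟨![⟨z 0, z 1⟩, ⟨z 2, z 3⟩, ⟨z 4 - (z 5 - α * z 4), z 5 - α * z 4⟩, ⟨z 6, m - z 6⟩],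
      Prod.ext (funext fun i => ?_) (by simp [φ])⟩
    change ((diagonalCoord α _ i : ℤ) : ZMod _) = y i
    rw [← hz]
    congr 1
    fin_cases i <;> simp [diagonalCoord] <;> ring
  have hker : (LinearMap.range D.mulVecLin).toAddSubgroup = φ.ker := by
    ext v
    have h1 : v ∈ φ.ker ↔ (∀ i, ((![a, a, b, b, s, f, c] i : ℕ) : ℤ) ∣ diagonalCoord α v i) ∧
        (v 3).re + (v 3).im = 0 := by
      rw [AddMonoidHom.mem_ker, Prod.ext_iff, funext_iff]
      refine and_congr (forall_congr' fun i => ?_) Iff.rfl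
      exact ZMod.intCast_zmod_eq_zero_iff_dvd _ _
    rw [h1]
    simp only [Submodule.mem_toAddSubgroup, LinearMap.mem_range, Matrix.mulVecLin_apply]
    constructor
    · rintro ⟨x, rfl⟩
      have hx (i : Fin 4) : D.mulVec x i =
          ![(a : ℤ√1), (b : ℤ√1), (k : ℤ√1) * F, (c : ℤ√1) * (1 - Zsqrtd.sqrtd)] i * x i :=
        Matrix.mulVec_diagonal _ _ _
      have x0 : D.mulVec x 0 = a * x 0 := hx 0
      have x1 : D.mulVec x 1 = b * x 1 := hx 1
      have x2 : D.mulVec x 2 = k * F * x 2 := hx 2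
      have x3 : D.mulVec x 3 = (c : ℤ√1) * (1 - Zsqrtd.sqrtd) * x 3 := hx 3
      have h5 : (((k : ℤ√1) * F) * x 2).re + (((k : ℤ√1) * F) * x 2).im =
          s * ((x 2).re + (x 2).im) := by
        simp [hs]; ring
      have h6 : α * (((k : ℤ√1) * F) * x 2).re + (α + 1) * (((k : ℤ√1) * F) * x 2).im =
          f * ((α + F.im) * ((x 2).re + (x 2).im) + (x 2).im) := by
        obtain ⟨p, q⟩ := F
        obtain rfl : p = q + 2 * α + 1 := by simp at hα; linarith
        simp [hf]; ring
      generalize D.mulVec x = v at *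
      refine ⟨fun i => ?_, by simp [x3]⟩
      rw [← x2] at h5 h6
      fin_cases i
      · exact ⟨(x 0).re, by simp [diagonalCoord, x0]⟩
      · exact ⟨(x 0).im, by simp [diagonalCoord, x0]⟩
      · exact ⟨(x 1).re, by simp [diagonalCoord, x1]⟩
      · exact ⟨(x 1).im, by simp [diagonalCoord, x1]⟩
      · exact ⟨_, h5⟩
      · exact ⟨_, h6⟩
      · exact ⟨(x 3).re - (x 3).im, by simp [diagonalCoord, x3]; ring⟩
    · rintro ⟨h, h7⟩
      choose m hm using h
      -- The third entry solves `re + im = m 4` and `(α + F.im)(re + im) + im = m 5`, the quotients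
      -- that occur in the other direction. In the last entry only `re - im` matters.
      refine ⟨![⟨m 0, m 1⟩, ⟨m 2, m 3⟩, ⟨m 4 - (m 5 - (α + F.im) * m 4), m 5 - (α + F.im) * m 4⟩,
        ⟨m 6, 0⟩], ?_⟩
      obtain ⟨p, q⟩ := F
      obtain rfl : p = q + 2 * α + 1 := by simp at hα; linarith
      have e0 : (v 0).re = a * m 0 := hm 0
      have e1 : (v 0).im = a * m 1 := hm 1
      have e2 : (v 1).re = b * m 2 := hm 2
      have e3 : (v 1).im = b * m 3 := hm 3
      have e4 : (v 2).re + (v 2).im = s * m 4 := hm 4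
      have e5 : α * (v 2).re + (α + 1) * (v 2).im = f * m 5 := hm 5
      have e6 : (v 3).re = c * m 6 := hm 6
      rw [hs] at e4
      rw [hf] at e5
      simp only at e4 e5
      ext i
      · fin_cases i <;> simp [Matrix.mulVec_diagonal, *]
        linear_combination (-(α + 1)) * e4 + e5
      · fin_cases i <;> simp [Matrix.mulVec_diagonal, *]
        · linear_combination α * e4 - e5
        · linear_combination e6 - h7
  exact ⟨(QuotientAddGroup.quotientAddEquivOfEq hker).trans
    (QuotientAddGroup.quotientKerEquivOfSurjective φ hsurj)⟩

theorem nonempty_torsion_quotient_diagonal_addEquiv {a b c s f : ℕ} (ha : 0 < a) (hb : 0 < b)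
    (hc : 0 < c) (hs0 : 0 < s) (hf0 : 0 < f) {k α : ℤ} {F : ℤ√1}
    (hα : F.re - F.im = 2 * α + 1) (hs : (s : ℤ) = k * (F.re + F.im))
    (hf : (f : ℤ) = k * (F.re - F.im)) {A : Type*} [AddCommGroup A]
    (h : Nonempty (A ≃+ ((Fin 4 → ℤ√1) ⧸ LinearMap.range (Matrix.mulVecLin (Matrix.diagonal
        ![(a : ℤ√1), (b : ℤ√1), (k : ℤ√1) * F, (c : ℤ√1) * (1 - Zsqrtd.sqrtd)]))))) :
    Nonempty (AddCommGroup.torsion A ≃+ ((i : Fin 7) → ZMod (![a, a, b, b, s, f, c] i))) := by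
  obtain ⟨e⟩ := h
  obtain ⟨e'⟩ := nonempty_diagonal_quotient_addEquiv a b c s f k α F hα hs hf
  have (i : Fin 7) : NeZero (![a, a, b, b, s, f, c] i) :=
    ⟨by fin_cases i <;> simp <;> omega⟩
  exact nonempty_torsion_addEquiv (e.trans e')

/-! ### The Laplacian of `C₄ × Cₙ` at a vertex. -/

section Laplacian

variable {V A : Type*} [Fintype V] [DecidableEq V] [AddCommGroup A]

theorem sum_lapMatrix_smul (G : SimpleGraph V) [DecidableRel G.Adj] (φ : V → A) (a : V) :
    ∑ b, G.lapMatrix ℤ b a • φ b = G.degree a • φ a - ∑ b ∈ G.neighborFinset a, φ b := by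
  simp only [SimpleGraph.lapMatrix, Matrix.sub_apply, sub_smul, Finset.sum_sub_distrib]
  congr 1
  · rw [Finset.sum_eq_single a] <;> simp +contextual [SimpleGraph.degMatrix, Matrix.diagonal]
  · rw [← Finset.sum_filter_add_sum_filter_not Finset.univ (fun b => G.Adj a b)]
    simp [SimpleGraph.adjMatrix_apply, G.adj_comm _ a, SimpleGraph.neighborFinset_eq_filter,
      Finset.sum_ite, Finset.filter_filter]

/-- The Laplacian of `C₄ × C_{m+3}` applied to a vertex. -/
theorem sum_lapMatrix_smul_cycle_boxProd (m : ℕ) [DecidableRel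
    (SimpleGraph.boxProd (SimpleGraph.cycleGraph 4) (SimpleGraph.cycleGraph (m + 3))).Adj]
    (φ : Fin 4 × Fin (m + 3) → A) (i : Fin 4) (k : Fin (m + 3)) :
    ∑ b, (SimpleGraph.boxProd (SimpleGraph.cycleGraph 4)
        (SimpleGraph.cycleGraph (m + 3))).lapMatrix ℤ b (i, k) • φ b =
      4 • φ (i, k) - (φ (i - 1, k) + φ (i + 1, k) + φ (i, k - 1) + φ (i, k + 1)) := by
  have h1 : i - 1 ≠ i + 1 := by decide +revert
  -- At least three layers are needed: for two, the neighbours `k ± 1` would coincide.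
  have h2 : k - 1 ≠ k + 1 := by
    intro h
    have h3 : (1 : Fin (m + 3)) + 1 = 0 := by
      have := congrArg (fun x => x - k + 1) h
      simpa [sub_eq_add_neg, add_comm, add_assoc, add_left_comm] using this.symm
    have := congrArg Fin.val h3
    simp only [Fin.val_add, Fin.val_one, Fin.val_zero] at this
    rw [Nat.mod_eq_of_lt (by omega)] at this
    omega
  rw [sum_lapMatrix_smul, SimpleGraph.degree_boxProd, SimpleGraph.neighborFinset_boxProd,
    Finset.sum_disjUnion, SimpleGraph.cycleGraph_degree_three_le (n := 1),
    SimpleGraph.cycleGraph_degree_three_le, SimpleGraph.cycleGraph_neighborFinset (n := 2),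
    SimpleGraph.cycleGraph_neighborFinset (n := m + 1)]
  have h3 : (i - 1, k) ≠ (i + 1, k) := by simp [h1]
  have h4 : (i, k - 1) ≠ (i, k + 1) := by simp [h2]
  simp [Finset.sum_pair h3, Finset.sum_pair h4, add_assoc]

end Laplacian

/-! ### The Laplacian cokernel as the cokernel of `Xⁿ - 1`. -/

theorem shiftMatrix_mulVec {R : Type*} [CommRing R] (J : R) (v : Fin 4 → R) :
    (shiftMatrix J).mulVec v =
      ![-v 2, -v 3, v 0 + (4 - 2 * J) * v 2, v 1 + J * v 2 + 4 * v 3] := by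
  ext i
  fin_cases i <;> simp [shiftMatrix, Matrix.mulVec, dotProduct, Fin.sum_univ_four]

/-- The elements `1, y, y², y³` of `ℤ[C₄] = ℤ[J] q ⊕ ℤ[J] k`. -/
def vertexVec : Fin 4 → Fin 4 → ℤ√1 :=
  ![![1, 0, 0, 0], ![Zsqrtd.sqrtd, 0, 0, 0], ![1, -1, 0, 0], ![Zsqrtd.sqrtd, -Zsqrtd.sqrtd, 0, 0]]

section Sequence

variable {A : Type*} [AddCommGroup A]

/-- The homomorphism sending `1, y, y², y³` to `c · k` and `x, x y, x y², x y³` to `c · (k + 1)`. -/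
def vertexLift (c : Fin 4 → ℕ → A) (k : ℕ) : (Fin 4 → ℤ√1) →+ A where
  toFun v := (v 0).re • c 0 k + (v 0).im • c 1 k + (v 1).re • (c 0 k - c 2 k) +
    (v 1).im • (c 1 k - c 3 k) + (v 2).re • c 0 (k + 1) + (v 2).im • c 1 (k + 1) +
    (v 3).re • (c 0 (k + 1) - c 2 (k + 1)) + (v 3).im • (c 1 (k + 1) - c 3 (k + 1))
  map_zero' := by simp
  map_add' v w := by
    simp only [Pi.add_apply, Zsqrtd.re_add, Zsqrtd.im_add]
    module

theorem vertexLift_apply (c : Fin 4 → ℕ → A) (k : ℕ) (v : Fin 4 → ℤ√1) : vertexLift c k v =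
    (v 0).re • c 0 k + (v 0).im • c 1 k + (v 1).re • (c 0 k - c 2 k) +
    (v 1).im • (c 1 k - c 3 k) + (v 2).re • c 0 (k + 1) + (v 2).im • c 1 (k + 1) +
    (v 3).re • (c 0 (k + 1) - c 2 (k + 1)) + (v 3).im • (c 1 (k + 1) - c 3 (k + 1)) := rfl

theorem vertexLift_vertexVec (c : Fin 4 → ℕ → A) (k : ℕ) (i : Fin 4) :
    vertexLift c k (vertexVec i) = c i k := by
  fin_cases i <;> simp [vertexLift_apply, vertexVec]

/-- A sequence obeying the Laplacian recurrence is governed by two consecutive layers, and `X` moves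
this window by one. -/
theorem vertexLift_shiftMatrix_mulVec {c : Fin 4 → ℕ → A}
    (hc : ∀ i k, 4 • c i (k + 1) = c (i - 1) (k + 1) + c (i + 1) (k + 1) + c i k + c i (k + 2))
    (k : ℕ) (v : Fin 4 → ℤ√1) :
    vertexLift c k ((shiftMatrix Zsqrtd.sqrtd).mulVec v) = vertexLift c (k + 1) v := by
  have hc' (i : Fin 4) : c i (k + 1 + 1) =
      4 • c i (k + 1) - (c (i - 1) (k + 1) + c (i + 1) (k + 1) + c i k) := by
    rw [hc]; abel
  rw [vertexLift_apply, vertexLift_apply, shiftMatrix_mulVec, hc' 0, hc' 1, hc' 2, hc' 3,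
    show (0 : Fin 4) - 1 = 3 from rfl, show (1 : Fin 4) - 1 = 0 from rfl,
    show (2 : Fin 4) - 1 = 1 from rfl, show (3 : Fin 4) - 1 = 2 from rfl,
    show (0 : Fin 4) + 1 = 1 from rfl, show (1 : Fin 4) + 1 = 2 from rfl,
    show (2 : Fin 4) + 1 = 3 from rfl, show (3 : Fin 4) + 1 = 0 from rfl]
  simp
  module

theorem vertexLift_pow_mulVec {c : Fin 4 → ℕ → A}
    (hc : ∀ i k, 4 • c i (k + 1) = c (i - 1) (k + 1) + c (i + 1) (k + 1) + c i k + c i (k + 2))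
    (k j : ℕ) (v : Fin 4 → ℤ√1) :
    vertexLift c k ((shiftMatrix Zsqrtd.sqrtd ^ j).mulVec v) = vertexLift c (k + j) v := by
  induction j generalizing k with
  | zero => simp
  | succ j ih =>
    rw [pow_succ', ← Matrix.mulVec_mulVec, vertexLift_shiftMatrix_mulVec hc, ih]
    congr 2; ring

theorem vertexLift_map {B : Type*} [AddCommGroup B] (f : A →+ B) (c : Fin 4 → ℕ → A) (k : ℕ)
    (v : Fin 4 → ℤ√1) : f (vertexLift c k v) = vertexLift (fun i k => f (c i k)) k v := by
  simp [vertexLift_apply]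

end Sequence

theorem shiftMatrix_sq_mulVec_vertexVec (i : Fin 4) :
    4 • (shiftMatrix Zsqrtd.sqrtd).mulVec (vertexVec i) =
      (shiftMatrix Zsqrtd.sqrtd).mulVec (vertexVec (i - 1)) +
      (shiftMatrix Zsqrtd.sqrtd).mulVec (vertexVec (i + 1)) + vertexVec i +
      (shiftMatrix Zsqrtd.sqrtd ^ 2).mulVec (vertexVec i) := by
  decide +revert

theorem vertexLift_pow_vertexVec (v : Fin 4 → ℤ√1) :
    vertexLift (fun i k => (shiftMatrix Zsqrtd.sqrtd ^ k).mulVec (vertexVec i)) 0 v = v := by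
  simp only [vertexLift_apply, zero_add, pow_zero, pow_one, shiftMatrix_mulVec, Matrix.one_mulVec]
  ext i <;> fin_cases i <;> simp [vertexVec]

theorem Fin.ofNat_succ_eq_add_one (n k : ℕ) :
    Fin.ofNat (n + 2) (k + 1) = Fin.ofNat (n + 2) k + 1 := by
  ext
  simp [Fin.val_add]

/-- Mutually inverse maps: `Φ` sends the vertex `(i, k)` to `Xᵏ yⁱ`, and `Ψ` evaluates a vector on
layers 0 and 1 of the vertex classes. Both descend because both families satisfy the same recurrence
and have period `m + 3`. -/
theorem nonempty_quotient_lapMatrix_addEquiv (m : ℕ) [DecidableRel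
    (SimpleGraph.boxProd (SimpleGraph.cycleGraph 4) (SimpleGraph.cycleGraph (m + 3))).Adj]
    {K : Submodule ℤ (Fin 4 × Fin (m + 3) → ℤ)} {L : Submodule (ℤ√1) (Fin 4 → ℤ√1)}
    (hK : K = LinearMap.range (Matrix.mulVecLin ((SimpleGraph.boxProd (SimpleGraph.cycleGraph 4)
      (SimpleGraph.cycleGraph (m + 3))).lapMatrix ℤ)))
    (hL : L = LinearMap.range
      (Matrix.mulVecLin (shiftMatrix (Zsqrtd.sqrtd : ℤ√1) ^ (m + 3) - 1))) :
    Nonempty (((Fin 4 × Fin (m + 3) → ℤ) ⧸ K) ≃+ ((Fin 4 → ℤ√1) ⧸ L)) := by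
  let π : (Fin 4 → ℤ√1) →+ ((Fin 4 → ℤ√1) ⧸ L) := L.mkQ.toAddMonoidHom
  let c (i : Fin 4) (k : ℕ) : (Fin 4 → ℤ√1) ⧸ L :=
    π ((shiftMatrix Zsqrtd.sqrtd ^ k).mulVec (vertexVec i))
  have hcper (i : Fin 4) : Function.Periodic (c i) (m + 3) := by
    intro k
    rw [← sub_eq_zero, ← map_sub]
    refine (Submodule.Quotient.mk_eq_zero L).2 (hL ▸
      ⟨(shiftMatrix Zsqrtd.sqrtd ^ k).mulVec (vertexVec i), ?_⟩)
    rw [Matrix.mulVecLin_apply, Matrix.sub_mulVec, Matrix.one_mulVec, Matrix.mulVec_mulVec,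
      ← pow_add, add_comm]
  have hcrec (i : Fin 4) (k : ℕ) :
      4 • c i (k + 1) = c (i - 1) (k + 1) + c (i + 1) (k + 1) + c i k + c i (k + 2) := by
    have := congrArg (fun v => π ((shiftMatrix Zsqrtd.sqrtd ^ k).mulVec v))
      (shiftMatrix_sq_mulVec_vertexVec i)
    simpa only [Matrix.mulVec_smul, Matrix.mulVec_add, Matrix.mulVec_mulVec, ← pow_succ, ← pow_add,
      map_add, map_nsmul] using this
  let φ (b : Fin 4 × Fin (m + 3)) : (Fin 4 → ℤ√1) ⧸ L := c b.1 b.2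
  have hφ (i : Fin 4) (k : ℕ) : c i k = φ (i, Fin.ofNat (m + 3) k) :=
    ((hcper i).map_mod_nat k).symm
  have hself (k : Fin (m + 3)) : Fin.ofNat (m + 3) k = k := by ext; simp
  let Φ₀ : (Fin 4 × Fin (m + 3) → ℤ) →ₗ[ℤ] ((Fin 4 → ℤ√1) ⧸ L) := Fintype.linearCombination ℤ φ
  have hΦ₀ : K ≤ LinearMap.ker Φ₀ := by
    rw [hK, LinearMap.range_le_ker_iff]
    refine LinearMap.pi_ext' fun ⟨i, k⟩ => LinearMap.ext_ring ?_
    change Φ₀ (Matrix.mulVec _ (Pi.single (i, k) 1)) = 0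
    rw [Matrix.mulVec_single_one, Fintype.linearCombination_apply]
    refine (sum_lapMatrix_smul_cycle_boxProd m φ i k).trans ?_
    -- Writing `k` as a successor gives the layers `k - 1`, `k`, `k + 1` the natural indices `p`, `p
    -- + 1`, `p + 2` of the recurrence.
    obtain ⟨p, rfl⟩ : ∃ p, k = Fin.ofNat (m + 3) (p + 1) :=
      ⟨(k - 1 : Fin (m + 3)).val, by rw [Fin.ofNat_succ_eq_add_one, hself, sub_add_cancel]⟩
    rw [← Fin.ofNat_succ_eq_add_one, ← hφ, ← hφ, ← hφ, ← hφ, Fin.ofNat_succ_eq_add_one,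
      add_sub_cancel_right, ← hφ, hcrec]
    abel
  let Φ : ((Fin 4 × Fin (m + 3) → ℤ) ⧸ K) →+ ((Fin 4 → ℤ√1) ⧸ L) := (K.liftQ Φ₀ hΦ₀).toAddMonoidHom
  let δ (b : Fin 4 × Fin (m + 3)) : (Fin 4 × Fin (m + 3) → ℤ) ⧸ K := K.mkQ (Pi.single b 1)
  have hδ (b) : Φ (δ b) = φ b := by
    change Φ₀ (Pi.single b 1) = φ b
    simp [Φ₀]
  have hsum (f : Fin 4 × Fin (m + 3) → ℤ) : K.mkQ f = ∑ b, f b • δ b := by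
    conv_lhs => rw [← Finset.univ_sum_single f, map_sum]
    refine Finset.sum_congr rfl fun b _ => ?_
    rw [← map_smul, ← Pi.single_smul, smul_eq_mul, mul_one]
  let d (i : Fin 4) (k : ℕ) : (Fin 4 × Fin (m + 3) → ℤ) ⧸ K := δ (i, Fin.ofNat (m + 3) k)
  have hdrec (i : Fin 4) (k : ℕ) :
      4 • d i (k + 1) = d (i - 1) (k + 1) + d (i + 1) (k + 1) + d i k + d i (k + 2) := by
    have h := sum_lapMatrix_smul_cycle_boxProd m δ i (Fin.ofNat (m + 3) (k + 1))
    rw [← Fin.ofNat_succ_eq_add_one, Fin.ofNat_succ_eq_add_one (m + 1) k, add_sub_cancel_right,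
      ← Fin.ofNat_succ_eq_add_one] at h
    rw [← sub_eq_zero]
    refine Eq.trans (Eq.symm ?_) (h.symm.trans ((hsum _).symm.trans
      ((Submodule.Quotient.mk_eq_zero K).2 (hK ▸ ⟨Pi.single (i, Fin.ofNat (m + 3) (k + 1)) 1,
          ?_⟩))))
    · simp only [d]
    · rw [Matrix.mulVecLin_apply, Matrix.mulVec_single_one]
      rfl
  have hdper (v) : vertexLift d (m + 3) v = vertexLift d 0 v := by
    have h0 (i : Fin 4) : d i (m + 3) = d i 0 := by
      simp only [d]; congr 2; ext; simp
    have h1 (i : Fin 4) : d i (m + 3 + 1) = d i (0 + 1) := by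
      simp only [d]; congr 2; ext; simp
    simp only [vertexLift_apply, h0, h1]
  let Ψ : ((Fin 4 → ℤ√1) ⧸ L) →+ ((Fin 4 × Fin (m + 3) → ℤ) ⧸ K) :=
    QuotientAddGroup.lift L.toAddSubgroup (vertexLift d 0) <| by
      intro w hw
      rw [Submodule.mem_toAddSubgroup, hL] at hw
      obtain ⟨v, rfl⟩ := hw
      rw [AddMonoidHom.mem_ker, Matrix.mulVecLin_apply, Matrix.sub_mulVec, Matrix.one_mulVec,
        map_sub, vertexLift_pow_mulVec hdrec, zero_add, hdper, sub_self]
  have hΨ (v) : Ψ (π v) = vertexLift d 0 v := rfl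
  have h1 : Ψ.comp Φ = AddMonoidHom.id _ := by
    refine AddMonoidHom.ext fun x => ?_
    obtain ⟨f, rfl⟩ := K.mkQ_surjective x
    rw [hsum, map_sum]
    refine Finset.sum_congr rfl fun b _ => ?_
    rw [map_zsmul, AddMonoidHom.comp_apply, hδ, hΨ, vertexLift_pow_mulVec hdrec,
      vertexLift_vertexVec, zero_add]
    simp only [d, hself, Prod.mk.eta]
  have h2 : Φ.comp Ψ = AddMonoidHom.id _ := by
    refine AddMonoidHom.ext fun x => ?_
    obtain ⟨v, rfl⟩ := L.mkQ_surjective x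
    change Φ (vertexLift d 0 v) = π v
    rw [vertexLift_map]
    simp only [d, hδ, ← hφ]
    rw [← vertexLift_map, vertexLift_pow_vertexVec]
  exact ⟨AddMonoidHom.toAddEquiv Φ Ψ h1 h2⟩

/-- The cokernel of the Laplacian of `C₄ × C_{m+3}` is that of the matrix `X ^ (m + 3) - 1`. -/
theorem nonempty_laplacianCokernel_addEquiv (m : ℕ) :
    Nonempty (LaplacianCokernel
        (SimpleGraph.boxProd (SimpleGraph.cycleGraph 4) (SimpleGraph.cycleGraph (m + 3))) ≃+
      ((Fin 4 → ℤ√1) ⧸ LinearMap.range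
        (Matrix.mulVecLin (shiftMatrix (Zsqrtd.sqrtd : ℤ√1) ^ (m + 3) - 1)))) := by
  classical
  refine nonempty_quotient_lapMatrix_addEquiv m ?_ rfl
  congr! 3

/-! ### The operators `uₖ(T)` over `ℤ[J]`. -/

/-- The action of `uₖ(T)` on `q`, where `T = 4 - w`: `uₖ(T) q = lucasQ k * q + lucasK k * k`. -/
def lucasQ : ℕ → ℤ√1
  | 0 => 0
  | 1 => 1
  | k + 2 => (4 - 2 * Zsqrtd.sqrtd) * lucasQ (k + 1) - lucasQ k

/-- The coefficient of `k` in `uₖ(T) q`, see `lucasQ`. -/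
def lucasK : ℕ → ℤ√1
  | 0 => 0
  | 1 => 0
  | k + 2 => 4 * lucasK (k + 1) + Zsqrtd.sqrtd * lucasQ (k + 1) - lucasK k

theorem sqrtd_one_mul_self : (Zsqrtd.sqrtd : ℤ√1) * Zsqrtd.sqrtd = 1 := Zsqrtd.dmuld

/-- Specialize `J = 1`: then `4 - 2J = 2`, and the recurrence becomes that of an arithmetic
progression. -/
theorem lucasQ_re_add_im (k : ℕ) : (lucasQ k).re + (lucasQ k).im = k := by
  induction k using Nat.twoStepInduction with
  | zero => simp [lucasQ]
  | one => simp [lucasQ]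
  | more k ih0 ih1 => simp [lucasQ] at ih1 ⊢; linear_combination 2 * ih1 - ih0

/-- Specialize `J = -1`: then `4 - 2J = 6`. -/
theorem lucasQ_re_sub_im (k : ℕ) : (lucasQ k).re - (lucasQ k).im = fSeq k := by
  induction k using Nat.twoStepInduction with
  | zero => simp [lucasQ, fSeq, lucasU]
  | one => simp [lucasQ, fSeq, lucasU]
  | more k ih0 ih1 =>
    rw [fSeq, lucasU_rec]
    simp only [fSeq] at ih0 ih1
    simp [lucasQ] at ih1 ⊢; linear_combination 6 * ih1 - ih0

/-- The functional `q ↦ 1`, `k ↦ 2` annihilates the image of `w`, so it is an eigenvector of the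
transpose of `T` with eigenvalue 4. -/
theorem lucasQ_add_two_mul_lucasK (k : ℕ) : lucasQ k + 2 * lucasK k = eSeq k := by
  have h (k : ℕ) : (eSeq (k + 2) : ℤ√1) = 4 * eSeq (k + 1) - eSeq k := by
    have := congrArg (Int.cast : ℤ → ℤ√1) (lucasU_rec 2 k)
    push_cast at this
    rw [eSeq, this, eSeq, eSeq]
  induction k using Nat.twoStepInduction with
  | zero => simp [lucasQ, lucasK, eSeq, lucasU]
  | one => simp [lucasQ, lucasK, eSeq, lucasU]
  | more k ih0 ih1 =>
    rw [h, ← ih0, ← ih1, lucasQ, lucasK]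
    ring

/-- On the ideal of `1 - J`, multiplication by `J` is `-1`. -/
theorem mul_one_sub_sqrtd (F : ℤ√1) :
    F * (1 - Zsqrtd.sqrtd) = ((F.re - F.im : ℤ) : ℤ√1) * (1 - Zsqrtd.sqrtd) := by
  ext <;> simp <;> ring

/-- The matrix of `uₖ(T)` on `M ⊕ x M`. -/
def lucasMatrix (k : ℕ) : Matrix (Fin 4) (Fin 4) (ℤ√1) :=
  blockMatrix (lucasQ k) (lucasK k) (eSeq k)

theorem lucasMatrix_zero : lucasMatrix 0 = 0 := by
  refine Matrix.ext fun i j => ?_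
  fin_cases i <;> fin_cases j <;> simp [lucasMatrix, blockMatrix, lucasQ, lucasK, eSeq, lucasU]

theorem lucasMatrix_one : lucasMatrix 1 = 1 := by
  refine Matrix.ext fun i j => ?_
  fin_cases i <;> fin_cases j <;> simp [lucasMatrix, blockMatrix, lucasQ, lucasK, eSeq, lucasU]

theorem blockMatrix_add {R : Type*} [CommRing R] (F B e F' B' e' : R) :
    blockMatrix F B e + blockMatrix F' B' e' = blockMatrix (F + F') (B + B') (e + e') := by
  simp [blockMatrix]

theorem lucasMatrix_add_two (k : ℕ) : lucasMatrix (k + 2) =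
    blockMatrix (4 - 2 * Zsqrtd.sqrtd) Zsqrtd.sqrtd 4 * lucasMatrix (k + 1) - lucasMatrix k := by
  have h : (eSeq (k + 2) : ℤ√1) = 4 * eSeq (k + 1) - eSeq k := by
    rw [← lucasQ_add_two_mul_lucasK, ← lucasQ_add_two_mul_lucasK, ← lucasQ_add_two_mul_lucasK,
      lucasQ, lucasK]
    ring
  rw [lucasMatrix, h, lucasQ, lucasK]
  refine Matrix.ext fun i j => ?_
  fin_cases i <;> fin_cases j <;>
    simp [lucasMatrix, blockMatrix] <;> ring

theorem shiftMatrix_mul_blockMatrix {R : Type*} [CommRing R] (J : R) :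
    shiftMatrix J * blockMatrix (4 - 2 * J) J 4 = shiftMatrix J ^ 2 + 1 := by
  ext i j
  fin_cases i <;> fin_cases j <;>
    simp [shiftMatrix, blockMatrix, pow_two]

theorem isUnit_shiftMatrix {R : Type*} [CommRing R] (J : R) : IsUnit (shiftMatrix J) := by
  refine .of_mul_eq_one (blockMatrix (4 - 2 * J) J 4 - shiftMatrix J) ?_
  rw [mul_sub, shiftMatrix_mul_blockMatrix, pow_two, add_sub_cancel_left]

theorem matrixEquiv_shiftMatrix_pow_odd (s : ℕ) :
    MatrixEquiv (shiftMatrix (Zsqrtd.sqrtd : ℤ√1) ^ (2 * s + 1) - 1)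
      (blockMatrix (lucasQ s + lucasQ (s + 1)) (lucasK s + lucasK (s + 1)) (hSeq s) *
        (shiftMatrix Zsqrtd.sqrtd - 1)) := by
  rw [← pow_mul_mul_sub_one (shiftMatrix_mul_blockMatrix _) lucasMatrix_zero lucasMatrix_one
    lucasMatrix_add_two, lucasMatrix, lucasMatrix, blockMatrix_add, hSeq, Nat.cast_add]
  exact MatrixEquiv.unit_mul ((isUnit_shiftMatrix _).pow _)

theorem matrixEquiv_shiftMatrix_pow_even {s : ℕ} (hs : 0 < s) :
    MatrixEquiv (shiftMatrix (Zsqrtd.sqrtd : ℤ√1) ^ (2 * s) - 1)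
      (blockMatrix (lucasQ s) (lucasK s) (eSeq s) * (shiftMatrix Zsqrtd.sqrtd ^ 2 - 1)) := by
  obtain ⟨k, rfl⟩ := Nat.exists_eq_add_one.2 hs
  rw [← pow_mul_mul_sq_sub_one (shiftMatrix_mul_blockMatrix _) lucasMatrix_zero lucasMatrix_one
    lucasMatrix_add_two]
  exact MatrixEquiv.unit_mul ((isUnit_shiftMatrix _).pow _)

/-! ### The critical group as an unordered sum of cyclic groups. -/

theorem nonempty_criticalGroup_addEquiv {n : ℕ} (hn : 3 ≤ n) {a b c s f : ℕ} (ha : 0 < a)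
    (hb : 0 < b) (hc : 0 < c) (hs0 : 0 < s) (hf0 : 0 < f) {k α : ℤ} {F : ℤ√1}
    (hα : F.re - F.im = 2 * α + 1) (hs : (s : ℤ) = k * (F.re + F.im))
    (hf : (f : ℤ) = k * (F.re - F.im))
    (h : MatrixEquiv (shiftMatrix (Zsqrtd.sqrtd : ℤ√1) ^ n - 1) (Matrix.diagonal
      ![(a : ℤ√1), (b : ℤ√1), (k : ℤ√1) * F, (c : ℤ√1) * (1 - Zsqrtd.sqrtd)])) :
    Nonempty (CriticalGroup
      (SimpleGraph.boxProd (SimpleGraph.cycleGraph 4) (SimpleGraph.cycleGraph n)) ≃+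
        ((i : Fin 7) → ZMod (![a, a, b, b, s, f, c] i))) := by
  obtain ⟨m, rfl⟩ := Nat.exists_eq_add_of_le' hn
  obtain ⟨e⟩ := nonempty_laplacianCokernel_addEquiv m
  obtain ⟨e'⟩ := h.nonempty_quotient_equiv
  exact nonempty_torsion_quotient_diagonal_addEquiv ha hb hc hs0 hf0 hα hs hf
    ⟨e.trans e'.toAddEquiv⟩

theorem nonempty_criticalGroup_addEquiv_of_odd {n s : ℕ} (hn : 3 ≤ n) (hs : n = 2 * s + 1)
    (hh : Odd (hSeq s)) (hg : Odd (gSeq s)) :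
    Nonempty (CriticalGroup
      (SimpleGraph.boxProd (SimpleGraph.cycleGraph 4) (SimpleGraph.cycleGraph n)) ≃+
        ((i : Fin 7) → ZMod (![hSeq s, hSeq s, hSeq s, hSeq s, n, gSeq s, 4 * gSeq s] i))) := by
  obtain ⟨j, hj⟩ := hh
  obtain ⟨α, hα⟩ := hg
  have hF : lucasQ s + lucasQ (s + 1) = 2 * (j : ℤ√1) + 1 + 2 * -(lucasK s + lucasK (s + 1)) := by
    have := congrArg (Nat.cast : ℕ → ℤ√1) hj
    push_cast [hSeq, ← lucasQ_add_two_mul_lucasK] at this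
    linear_combination this
  have hsub : (lucasQ s + lucasQ (s + 1)).re - (lucasQ s + lucasQ (s + 1)).im = gSeq s := by
    have h0 := lucasQ_re_sub_im s
    have h1 := lucasQ_re_sub_im (s + 1)
    push_cast [gSeq, Zsqrtd.re_add, Zsqrtd.im_add]
    linear_combination h0 + h1
  have hadd : (lucasQ s + lucasQ (s + 1)).re + (lucasQ s + lucasQ (s + 1)).im = n := by
    have h0 := lucasQ_re_add_im s
    have h1 := lucasQ_re_add_im (s + 1)
    push_cast [hs, Zsqrtd.re_add, Zsqrtd.im_add] at h1 ⊢
    linear_combination h0 + h1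
  refine nonempty_criticalGroup_addEquiv hn (k := 1) (α := α) (by omega) (by omega) (by omega)
    (by omega) (by omega) (F := lucasQ s + lucasQ (s + 1)) ?_ ?_ ?_ ?_
  · rw [hsub, hα]; push_cast; ring
  · rw [hadd, one_mul]
  · rw [hsub, one_mul]
  · have h := (matrixEquiv_shiftMatrix_pow_odd s).trans (by
      have := matrixEquiv_mul_shiftMatrix_sub_one sqrtd_one_mul_self (j : ℤ√1)
        (-(lucasK s + lucasK (s + 1)))
      rwa [← hF, neg_neg, mul_assoc 4, mul_one_sub_sqrtd, hsub,
        show 2 * (j : ℤ√1) + 1 = (hSeq s : ℕ) by rw [hj]; push_cast; ring] at this)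
    rw [hs]
    refine (congrArg (fun v => MatrixEquiv _ (Matrix.diagonal v)) (funext fun i => ?_)).mp h
    fin_cases i <;> simp [mul_assoc]

theorem nonempty_criticalGroup_addEquiv_of_odd_half {n s : ℕ} (hn : 3 ≤ n) (hs : n = 2 * s)
    (he : Odd (eSeq s)) (hf : Odd (fSeq s)) :
    Nonempty (CriticalGroup
      (SimpleGraph.boxProd (SimpleGraph.cycleGraph 4) (SimpleGraph.cycleGraph n)) ≃+
        ((i : Fin 7) → ZMod (![eSeq s, eSeq s, 12 * eSeq s, 12 * eSeq s, s, fSeq s,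
          16 * fSeq s] i))) := by
  obtain ⟨j, hj⟩ := he
  obtain ⟨α, hα⟩ := hf
  have hF : lucasQ s = 2 * (j : ℤ√1) + 1 + 2 * -lucasK s := by
    have := congrArg (Nat.cast : ℕ → ℤ√1) hj
    push_cast [← lucasQ_add_two_mul_lucasK] at this
    linear_combination this
  have hsub := lucasQ_re_sub_im s
  refine nonempty_criticalGroup_addEquiv hn (k := 1) (α := α) (by omega) (by omega) (by omega)
    (by omega) (by omega) (F := lucasQ s) ?_ ?_ ?_ ?_
  · rw [hsub, hα]; push_cast; ring
  · rw [lucasQ_re_add_im, one_mul]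
  · rw [hsub, one_mul]
  · have h := (matrixEquiv_shiftMatrix_pow_even (by omega : 0 < s)).trans (by
      have := matrixEquiv_mul_shiftMatrix_sq_sub_one_of_odd sqrtd_one_mul_self (j : ℤ√1)
        (-lucasK s)
      rwa [← hF, neg_neg, mul_assoc 16, mul_one_sub_sqrtd, hsub,
        show 2 * (j : ℤ√1) + 1 = (eSeq s : ℕ) by rw [hj]; push_cast; ring] at this)
    rw [hs]
    refine (congrArg (fun v => MatrixEquiv _ (Matrix.diagonal v)) (funext fun i => ?_)).mp h
    fin_cases i <;> simp [mul_assoc]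

theorem nonempty_criticalGroup_addEquiv_of_even_half {n s : ℕ} (hn : 3 ≤ n) (hs : n = 2 * s)
    {d j p q : ℤ} (he0 : 0 < eSeq s) (hf0 : 0 < fSeq s) (he : (eSeq s : ℤ) = d * (4 * (2 * j + 1)))
    (hsd : (s : ℤ) = 2 * d * (1 + 2 * p + 2 * q))
    (hf : (fSeq s : ℤ) = 2 * d * (2 * p - 2 * q - 1)) :
    Nonempty (CriticalGroup
      (SimpleGraph.boxProd (SimpleGraph.cycleGraph 4) (SimpleGraph.cycleGraph n)) ≃+
        ((i : Fin 7) → ZMod (![2 * eSeq s, 2 * eSeq s, 6 * eSeq s, 6 * eSeq s, s, fSeq s,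
          16 * fSeq s] i))) := by
  have hadd := lucasQ_re_add_im s
  have hsub := lucasQ_re_sub_im s
  have hF : lucasQ s = (d : ℤ√1) * (2 * (Zsqrtd.sqrtd + 2 * (⟨p, q⟩ : ℤ√1))) := by
    ext
    · simp; linarith
    · simp; linarith
  have heS : (eSeq s : ℤ√1) = (d : ℤ√1) * (4 * (2 * (j : ℤ√1) + 1)) := by
    exact_mod_cast congrArg (Int.cast : ℤ → ℤ√1) he
  have hB : lucasK s =
      (d : ℤ√1) * (2 * (2 * (j : ℤ√1) + 1) - (Zsqrtd.sqrtd + 2 * (⟨p, q⟩ : ℤ√1))) := by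
    have h := lucasQ_add_two_mul_lucasK s
    rw [hF, heS] at h
    have h2 : (2 : ℤ√1) * lucasK s =
        2 * ((d : ℤ√1) * (2 * (2 * (j : ℤ√1) + 1) - (Zsqrtd.sqrtd + 2 * (⟨p, q⟩ : ℤ√1)))) := by
      linear_combination h
    -- `ℤ√1` has zero divisors, but the integer 2 can still be cancelled.
    exact Zsqrtd.eq_of_smul_eq_smul_left (a := 2) (by norm_num) (by exact_mod_cast h2)
  refine nonempty_criticalGroup_addEquiv hn (k := 2 * d) (α := p - q - 1) (by omega) (by omega)
    (by omega) (by omega) (by omega) (F := Zsqrtd.sqrtd + 2 * (⟨p, q⟩ : ℤ√1)) ?_ ?_ ?_ ?_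
  · simp; ring
  · simp; linarith
  · simp; linarith
  · have h := (matrixEquiv_shiftMatrix_pow_even (by omega : 0 < s)).trans (by
      have := matrixEquiv_mul_shiftMatrix_sq_sub_one_of_even sqrtd_one_mul_self (d : ℤ√1)
        (j : ℤ√1) ⟨p, q⟩
      rwa [← hF, ← hB, ← heS] at this)
    rw [hs]
    refine (congrArg (fun v => MatrixEquiv _ (Matrix.diagonal v)) (funext fun i => ?_)).mp h
    have hf' : (fSeq s : ℤ√1) = 2 * d * (2 * p - 2 * q - 1) := by
      exact_mod_cast congrArg (Int.cast : ℤ → ℤ√1) hf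
    fin_cases i
    · simp [heS]; ring
    · simp [heS]; ring
    · simp
    · simp [hf', mul_assoc, mul_one_sub_sqrtd (Zsqrtd.sqrtd + _)]; ring

/-! ### Exchanging cyclic factors. -/

section CyclicFactors

variable {ι : Type*}

/-- Products of cyclic groups which correspond to the same lattice under a surjective endomorphism
of `ℤ ^ ι` are isomorphic. -/
theorem nonempty_pi_zmod_addEquiv_of_hom {t t' : ι → ℕ}
    (σ : (ι → ℤ) →+ (ι → ℤ)) (hσ : Function.Surjective σ)
    (h : ∀ z, (∀ l, (t l : ℤ) ∣ z l) ↔ ∀ l, (t' l : ℤ) ∣ σ z l) :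
    Nonempty (((l : ι) → ZMod (t l)) ≃+ ((l : ι) → ZMod (t' l))) := by
  let ρ (t : ι → ℕ) : (ι → ℤ) →+ ((l : ι) → ZMod (t l)) :=
    { toFun := fun z l => (z l : ZMod (t l))
      map_zero' := by ext; simp
      map_add' := fun z w => by ext; simp }
  have hρ (t : ι → ℕ) : Function.Surjective (ρ t) := by
    intro y
    choose z hz using fun l => ZMod.intCast_surjective (y l)
    exact ⟨z, funext hz⟩
  have hker (t : ι → ℕ) (z : ι → ℤ) : ρ t z = 0 ↔ ∀ l, (t l : ℤ) ∣ z l := by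
    rw [funext_iff]
    exact forall_congr' fun l => ZMod.intCast_zmod_eq_zero_iff_dvd _ _
  have hk : (ρ t).ker = ((ρ t').comp σ).ker := by
    ext z
    rw [AddMonoidHom.mem_ker, AddMonoidHom.mem_ker, AddMonoidHom.comp_apply, hker, hker, h]
  exact ⟨(QuotientAddGroup.quotientKerEquivOfSurjective (ρ t) (hρ t)).symm.trans
    ((QuotientAddGroup.quotientAddEquivOfEq hk).trans
      (QuotientAddGroup.quotientKerEquivOfSurjective ((ρ t').comp σ) ((hρ t').comp hσ)))⟩

theorem nonempty_pi_zmod_addEquiv_of_perm {t t' : ι → ℕ} (σ : Equiv.Perm ι)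
    (h : ∀ l, t' l = t (σ l)) :
    Nonempty (((l : ι) → ZMod (t l)) ≃+ ((l : ι) → ZMod (t' l))) := by
  refine nonempty_pi_zmod_addEquiv_of_hom
    ⟨⟨fun z l => z (σ l), rfl⟩, fun _ _ => rfl⟩ (fun w => ⟨fun l => w (σ.symm l), ?_⟩) fun z => ?_
  · ext l
    simp
  · simp only [h]
    exact (σ.forall_congr_right (q := fun l => (t l : ℤ) ∣ z l)).symm

/-- Replacing two cyclic factors `ℤ/a` and `ℤ/b` by `ℤ/gcd a b` and `ℤ/lcm a b`. -/
theorem nonempty_pi_zmod_addEquiv_of_gcd [DecidableEq ι] {t t' : ι → ℕ} (i j : ι) (hij : i ≠ j)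
    (hpos : 0 < t i) (h : ∀ l, l ≠ i → l ≠ j → t' l = t l) (hi : (t i).gcd (t j) = t' i)
    (hj : t' i * t' j = t i * t j) :
    Nonempty (((l : ι) → ZMod (t l)) ≃+ ((l : ι) → ZMod (t' l))) := by
  have hg : 0 < (t i).gcd (t j) := Nat.gcd_pos_of_pos_left _ hpos
  obtain ⟨a, ha⟩ := Nat.gcd_dvd_left (t i) (t j)
  obtain ⟨b, hb⟩ := Nat.gcd_dvd_right (t i) (t j)
  have hbez := Nat.gcd_eq_gcd_ab (t i) (t j)
  set x := Nat.gcdA (t i) (t j)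
  set y := Nat.gcdB (t i) (t j)
  set g := (t i).gcd (t j)
  have hl : t' j = g * a * b := by
    apply Nat.eq_of_mul_eq_mul_left hg
    rw [← hi] at hj
    rw [hj, ha, hb]
    ring
  have hbez' : (a : ℤ) * x + b * y = 1 := by
    have hg' : (g : ℤ) ≠ 0 := by exact_mod_cast hg.ne'
    apply mul_left_cancel₀ hg'
    have ha' : (t i : ℤ) = g * a := by exact_mod_cast ha
    have hb' : (t j : ℤ) = g * b := by exact_mod_cast hb
    rw [ha', hb'] at hbez
    linear_combination -hbez
  -- On the coordinates `i`, `j` this is the matrix `[[x, y], [-b, a]]`, of determinant `a x + b y =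
  -- 1`.
  let σ : (ι → ℤ) →+ (ι → ℤ) :=
    { toFun := fun z l => if l = i then x * z i + y * z j else if l = j then a * z j - b * z i else
        z l
      map_zero' := by ext; simp
      map_add' := fun z w => by
        ext l
        simp only [Pi.add_apply]
        split_ifs <;> ring }
  have σi (z) : σ z i = x * z i + y * z j := if_pos rfl
  have σj (z) : σ z j = a * z j - b * z i := (if_neg hij.symm).trans (if_pos rfl)
  have σl (z) (l) (h1 : l ≠ i) (h2 : l ≠ j) : σ z l = z l := (if_neg h1).trans (if_neg h2)
  refine nonempty_pi_zmod_addEquiv_of_hom σ (fun w => ⟨fun l => if l = i then a * w i - y * w j else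
    if l = j then b * w i + x * w j else w l, ?_⟩) fun z => ?_
  · ext l
    by_cases h1 : l = i
    · subst h1
      rw [σi, if_pos rfl, if_neg hij.symm, if_pos rfl]
      linear_combination w l * hbez'
    by_cases h2 : l = j
    · subst h2
      rw [σj, if_pos rfl, if_neg hij.symm, if_pos rfl]
      linear_combination w l * hbez'
    rw [σl _ _ h1 h2, if_neg h1, if_neg h2]
  · constructor
    · intro hz l
      obtain ⟨c, hc⟩ := hz i
      obtain ⟨d, hd⟩ := hz j
      by_cases h1 : l = i
      · subst h1
        rw [σi, ← hi, hc, hd, ha, hb]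
        exact ⟨x * a * c + y * b * d, by push_cast; ring⟩
      by_cases h2 : l = j
      · subst h2
        rw [σj, hl, hc, hd, ha, hb]
        exact ⟨d - c, by push_cast; ring⟩
      rw [σl _ _ h1 h2, h l h1 h2]
      exact hz l
    · intro hz l
      obtain ⟨c, hc⟩ := hz i
      obtain ⟨d, hd⟩ := hz j
      rw [σi, ← hi] at hc
      rw [σj, hl] at hd
      by_cases h1 : l = i
      · subst h1
        refine ⟨c - y * b * d, ?_⟩
        rw [ha]
        push_cast at hd ⊢
        linear_combination a * hc - y * hd - z l * hbez'
      by_cases h2 : l = j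
      · subst h2
        refine ⟨c + x * a * d, ?_⟩
        rw [hb]
        push_cast at hd ⊢
        linear_combination b * hc + x * hd - z l * hbez'
      have := hz l
      rwa [σl _ _ h1 h2, h l h1 h2] at this

end CyclicFactors

/-! ### From cyclic sums to invariant factors, prime by prime. -/

theorem Nat.factorization_gcd_apply {a b : ℕ} (ha : a ≠ 0) (hb : b ≠ 0) (p : ℕ) :
    (a.gcd b).factorization p = min (a.factorization p) (b.factorization p) := by
  rw [Nat.factorization_gcd ha hb]; rfl

theorem Nat.factorization_lcm_apply {a b : ℕ} (ha : a ≠ 0) (hb : b ≠ 0) (p : ℕ) :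
    (a.lcm b).factorization p = max (a.factorization p) (b.factorization p) := by
  rw [Nat.factorization_lcm ha hb]; rfl

theorem Nat.factorization_mul_apply {a b : ℕ} (ha : a ≠ 0) (hb : b ≠ 0) (p : ℕ) :
    (a * b).factorization p = a.factorization p + b.factorization p := by
  rw [Nat.factorization_mul ha hb]; rfl

theorem Nat.factorization_two_pow_mul_three_pow (a b p : ℕ) :
    (2 ^ a * 3 ^ b).factorization p =
      a * Nat.factorization 2 p + b * Nat.factorization 3 p := by
  rw [Nat.factorization_mul_apply (by positivity) (by positivity), Nat.factorization_pow,
    Nat.factorization_pow]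
  rfl

/-- All numerical constants are products of powers of 2 and 3, so these three cases turn each
gcd–lcm identity into linear arithmetic with `min` and `max`. -/
theorem Nat.factorization_two_three (p : ℕ) :
    (p = 2 ∧ Nat.factorization 2 p = 1 ∧ Nat.factorization 3 p = 0) ∨
    (p = 3 ∧ Nat.factorization 2 p = 0 ∧ Nat.factorization 3 p = 1) ∨
    (p ≠ 2 ∧ p ≠ 3 ∧ Nat.factorization 2 p = 0 ∧ Nat.factorization 3 p = 0) := by
  rw [Nat.prime_two.factorization, Nat.prime_three.factorization]
  simp only [Finsupp.single_apply]
  by_cases h2 : p = 2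
  · simp [h2]
  by_cases h3 : p = 3
  · simp [h3]
  simp [h2, h3, Ne.symm h2, Ne.symm h3]

theorem hasInvariantFactors_of_addEquiv {A : Type*} [AddCommGroup A] {k : ℕ} {t : Fin (k + 1) → ℕ}
    (hpos : ∀ i, 0 < t i) (hdvd : ∀ i : Fin k, t i.castSucc ∣ t i.succ)
    (h : Nonempty (A ≃+ ((i : Fin (k + 1)) → ZMod (t i)))) : HasInvariantFactors A t := by
  refine ⟨hpos, fun i j hij => ?_, h⟩
  rcases hij.eq_or_lt with rfl | hlt
  · exact dvd_rfl
  · exact (Fin.liftFun_iff_succ (· ∣ ·)).2 hdvd hlt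

theorem hasInvariantFactors_seven {A : Type*} [AddCommGroup A] {a b c d e f g : ℕ} (ha : a ≠ 0)
    (hg : g ≠ 0) (hab : a ∣ b) (hbc : b ∣ c) (hcd : c ∣ d) (hde : d ∣ e) (hef : e ∣ f) (hfg : f ∣ g)
    (h : Nonempty (A ≃+ ((i : Fin 7) → ZMod (![a, b, c, d, e, f, g] i)))) :
    HasInvariantFactors A ![a, b, c, d, e, f, g] := by
  have h5 := ne_zero_of_dvd_ne_zero hg hfg
  have h4 := ne_zero_of_dvd_ne_zero h5 hef
  have h3 := ne_zero_of_dvd_ne_zero h4 hde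
  have h2 := ne_zero_of_dvd_ne_zero h3 hcd
  have h1 := ne_zero_of_dvd_ne_zero h2 hbc
  refine hasInvariantFactors_of_addEquiv ?_ ?_ h
  · simp [Fin.forall_fin_succ, Nat.pos_iff_ne_zero, *]
  · simp [Fin.forall_fin_succ, *]

set_option linter.unusedSimpArgs false

theorem nonempty_pi_zmod_addEquiv_swap_pairs (a b c d e f g : ℕ) :
    Nonempty (((l : Fin 7) → ZMod (![a, b, c, d, e, f, g] l)) ≃+
      ((l : Fin 7) → ZMod (![c, d, a, b, e, f, g] l))) :=
  nonempty_pi_zmod_addEquiv_of_perm (Equiv.swap 0 2 * Equiv.swap 1 3)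
    (by simp [Fin.forall_fin_succ, Equiv.swap_apply_def])

theorem nonempty_pi_zmod_addEquiv_swap (a b c d e f g : ℕ) :
    Nonempty (((l : Fin 7) → ZMod (![a, b, c, d, e, f, g] l)) ≃+
      ((l : Fin 7) → ZMod (![c, b, a, d, e, f, g] l))) :=
  nonempty_pi_zmod_addEquiv_of_perm (Equiv.swap 0 2) (by simp [Fin.forall_fin_succ,
      Equiv.swap_apply_def])

/-- Five gcd–lcm exchanges. The intermediate orders are free variables so that the caller can supply
them in closed form. -/
theorem nonempty_pi_zmod_addEquiv_of_odd {a b c d e f g i j k m n o : ℕ}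
    (ha : 0 < a) (he : 0 < e) (hm : 0 < m)
    (hg0 : a.gcd c = e) (hl0 : e * f = a * c)
    (hg1 : a.gcd d = e) (hl1 : e * g = a * d)
    (hg2 : e.gcd b = i) (hl2 : i * j = e * b)
    (hg3 : a.gcd j = k) (hl3 : k * m = a * j)
    (hg4 : m.gcd g = n) (hl4 : n * o = m * g) :
    Nonempty (((l : Fin 7) → ZMod (![a, a, a, a, b, c, d] l)) ≃+
      ((l : Fin 7) → ZMod (![i, e, k, a, n, f, o] l))) := by
  obtain ⟨b0⟩ := nonempty_pi_zmod_addEquiv_of_gcd (t := ![a, a, a, a, b, c, d])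
    (t' := ![e, a, a, a, b, f, d]) 0 5 (by decide) ha
    (by simp [Fin.forall_fin_succ]) hg0 hl0
  obtain ⟨b1⟩ := nonempty_pi_zmod_addEquiv_of_gcd (t := ![e, a, a, a, b, f, d])
    (t' := ![e, e, a, a, b, f, g]) 1 6 (by decide) ha
    (by simp [Fin.forall_fin_succ]) hg1 hl1
  obtain ⟨b2⟩ := nonempty_pi_zmod_addEquiv_of_gcd (t := ![e, e, a, a, b, f, g])
    (t' := ![i, e, a, a, j, f, g]) 0 4 (by decide) he
    (by simp [Fin.forall_fin_succ]) hg2 hl2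
  obtain ⟨b3⟩ := nonempty_pi_zmod_addEquiv_of_gcd (t := ![i, e, a, a, j, f, g])
    (t' := ![i, e, k, a, m, f, g]) 2 4 (by decide) ha
    (by simp [Fin.forall_fin_succ]) hg3 hl3
  obtain ⟨b4⟩ := nonempty_pi_zmod_addEquiv_of_gcd (t := ![i, e, k, a, m, f, g])
    (t' := ![i, e, k, a, n, f, o]) 4 6 (by decide) hm
    (by simp [Fin.forall_fin_succ]) hg4 hl4
  exact ⟨(((b0.trans b1).trans b2).trans b3).trans b4⟩

theorem hasInvariantFactors_of_odd {A : Type*} [AddCommGroup A] {n h g : ℕ} (hn : Odd n)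
    (hh : Odd h) (hg : Odd g)
    (hA : Nonempty (A ≃+ ((i : Fin 7) → ZMod (![h, h, h, h, n, g, 4 * g] i)))) :
    gcd3 n h g ∣ n.gcd h * h.gcd g ∧
    n.gcd h * h.gcd g ∣ h * gcd3 (n * h) (n * g) (h * g) ∧
    h.gcd g ∣ h * g ∧
    gcd3 (n * h) (n * g) (h * g) ∣ 4 * n * h * g ∧
    HasInvariantFactors A
      ![gcd3 n h g,
        h.gcd g,
        (n.gcd h * h.gcd g) / gcd3 n h g,
        h,
        (h * gcd3 (n * h) (n * g) (h * g)) / (n.gcd h * h.gcd g),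
        (h * g) / h.gcd g,
        (4 * n * h * g) / gcd3 (n * h) (n * g) (h * g)] := by
  have h1 : n ≠ 0 := hn.pos.ne'
  have h2 : h ≠ 0 := hh.pos.ne'
  have h3 : g ≠ 0 := hg.pos.ne'
  have c4 := Nat.factorization_two_pow_mul_three_pow 2 0
  norm_num only at c4
  have key : ∀ p, p = 2 → n.factorization p = 0 ∧ h.factorization p = 0 ∧
      g.factorization p = 0 := by
    rintro _ rfl
    exact ⟨Nat.factorization_eq_zero_of_not_dvd hn.not_two_dvd_nat,
      Nat.factorization_eq_zero_of_not_dvd hh.not_two_dvd_nat,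
      Nat.factorization_eq_zero_of_not_dvd hg.not_two_dvd_nat⟩
  -- The pairs `g`, `l` justify the exchanges; the `d` identities rewrite the stated fractions as
  -- gcd–lcm expressions. Oddness of `h` lets the 4 drop out of `gcd(h, 4g)`.
  obtain ⟨g0, l0, g1, l1, g2, l2, g3, l3, g4, l4, d0, d1, d2, d3⟩ :
      (h).gcd (g) = h.gcd g ∧
      (h.gcd g) * (h.lcm g) = (h) * (g) ∧
      (h).gcd (4 * g) = h.gcd g ∧
      (h.gcd g) * (4 * h.lcm g) = (h) * (4 * g) ∧
      (h.gcd g).gcd (n) = gcd3 n h g ∧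
      (gcd3 n h g) * (n.lcm (h.gcd g)) = (h.gcd g) * (n) ∧
      (h).gcd (n.lcm (h.gcd g)) = (n.gcd h).lcm (h.gcd g) ∧
      ((n.gcd h).lcm (h.gcd g)) * (h.lcm n) = (h) * (n.lcm (h.gcd g)) ∧
      (h.lcm n).gcd (4 * h.lcm g) = (h.lcm n).gcd (h.lcm g) ∧
      ((h.lcm n).gcd (h.lcm g)) * (4 * h.lcm (n.lcm g)) = (h.lcm n) * (4 * h.lcm g) ∧
      n.gcd h * h.gcd g = ((n.gcd h).lcm (h.gcd g)) * (gcd3 n h g) ∧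
      h * gcd3 (n * h) (n * g) (h * g) = ((h.lcm n).gcd (h.lcm g)) * (n.gcd h * h.gcd g) ∧
      h * g = (h.lcm g) * (h.gcd g) ∧
      4 * n * h * g = (4 * h.lcm (n.lcm g)) * (gcd3 (n * h) (n * g) (h * g)) := by
    refine ⟨?_, ?_, ?_, ?_, ?_, ?_, ?_, ?_, ?_, ?_, ?_, ?_, ?_, ?_⟩ <;>
    · refine Nat.eq_of_factorization_eq (by simp [gcd3, h1, h2, h3]) (by simp [gcd3, h1, h2, h3])
        fun p => ?_
      have q := Nat.factorization_two_three p
      have hp := key p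
      simp only [gcd3, Nat.factorization_mul_apply, Nat.factorization_gcd_apply,
        Nat.factorization_lcm_apply, ne_eq, mul_eq_zero, Nat.gcd_eq_zero_iff, Nat.lcm_eq_zero_iff,
        OfNat.ofNat_ne_zero, or_self, and_self, not_false_eq_true, h1, h2, h3, c4]
      all_goals omega
  obtain ⟨a0, a1, a2, a3, a4, a5⟩ :
      gcd3 n h g ∣ h.gcd g ∧
      h.gcd g ∣ (n.gcd h).lcm (h.gcd g) ∧
      (n.gcd h).lcm (h.gcd g) ∣ h ∧
      h ∣ (h.lcm n).gcd (h.lcm g) ∧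
      (h.lcm n).gcd (h.lcm g) ∣ h.lcm g ∧
      h.lcm g ∣ 4 * h.lcm (n.lcm g) := by
    refine ⟨?_, ?_, ?_, ?_, ?_, ?_⟩ <;>
    · refine (Nat.factorization_le_iff_dvd (by simp [gcd3, h1, h2, h3]) (by simp [gcd3, h1, h2,
        h3])).1 fun p => ?_
      have q := Nat.factorization_two_three p
      have hp := key p
      simp only [gcd3, Nat.factorization_mul_apply, Nat.factorization_gcd_apply,
        Nat.factorization_lcm_apply, ne_eq, mul_eq_zero, Nat.gcd_eq_zero_iff, Nat.lcm_eq_zero_iff,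
        OfNat.ofNat_ne_zero, or_self, and_self, not_false_eq_true, h1, h2, h3, c4]
      all_goals omega
  refine ⟨⟨_, d0.trans (mul_comm _ _)⟩, ⟨_, d1.trans (mul_comm _ _)⟩, ⟨_, d2.trans (mul_comm _ _)⟩,
      ⟨_, d3.trans (mul_comm _ _)⟩, ?_⟩
  rw [Nat.div_eq_of_eq_mul_left (Nat.pos_of_ne_zero (by simp [gcd3, h1, h2, h3])) d0,
      Nat.div_eq_of_eq_mul_left (Nat.pos_of_ne_zero (by simp [gcd3, h1, h2, h3])) d1,
      Nat.div_eq_of_eq_mul_left (Nat.pos_of_ne_zero (by simp [gcd3, h1, h2, h3])) d2,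
      Nat.div_eq_of_eq_mul_left (Nat.pos_of_ne_zero (by simp [gcd3, h1, h2, h3])) d3]
  obtain ⟨b⟩ := hA
  obtain ⟨c⟩ := nonempty_pi_zmod_addEquiv_of_odd (Nat.pos_of_ne_zero (by simp [gcd3, h1, h2, h3]))
      (Nat.pos_of_ne_zero (by simp [gcd3, h1, h2, h3])) (Nat.pos_of_ne_zero (by simp [gcd3, h1, h2,
      h3])) g0 l0 g1 l1 g2 l2 g3 l3 g4 l4
  exact hasInvariantFactors_seven (by simp [gcd3, h1, h2, h3]) (by simp [gcd3, h1, h2, h3]) a0 a1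
      a2 a3 a4 a5 ⟨b.trans c⟩

/-- The last exchange is there to move the factor 4, left in slot 1 by `gcd(12e, 16f) = 4 gcd(e,
f)`, over to slot 4. -/
theorem nonempty_pi_zmod_addEquiv_of_odd_half {a b c d e f g i j k m n o p q r : ℕ}
    (ha : 0 < a) (hi : 0 < i) (hb : 0 < b) (ho : 0 < o) (hf : 0 < f)
    (hg0 : a.gcd e = f) (hl0 : f * g = a * e)
    (hg1 : a.gcd d = i) (hl1 : i * j = a * d)
    (hg2 : i.gcd c = k) (hl2 : k * m = i * c)
    (hg3 : b.gcd m = n) (hl3 : n * o = b * m)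
    (hg4 : o.gcd g = p) (hl4 : p * q = o * g)
    (hg5 : f.gcd p = i) (hl5 : i * r = f * p) :
    Nonempty (((l : Fin 7) → ZMod (![a, a, b, b, c, d, e] l)) ≃+
      ((l : Fin 7) → ZMod (![k, i, n, b, r, j, q] l))) := by
  obtain ⟨b0⟩ := nonempty_pi_zmod_addEquiv_of_gcd (t := ![a, a, b, b, c, d, e])
    (t' := ![a, f, b, b, c, d, g]) 1 6 (by decide) ha
    (by simp [Fin.forall_fin_succ]) hg0 hl0
  obtain ⟨b1⟩ := nonempty_pi_zmod_addEquiv_of_gcd (t := ![a, f, b, b, c, d, g])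
    (t' := ![i, f, b, b, c, j, g]) 0 5 (by decide) ha
    (by simp [Fin.forall_fin_succ]) hg1 hl1
  obtain ⟨b2⟩ := nonempty_pi_zmod_addEquiv_of_gcd (t := ![i, f, b, b, c, j, g])
    (t' := ![k, f, b, b, m, j, g]) 0 4 (by decide) hi
    (by simp [Fin.forall_fin_succ]) hg2 hl2
  obtain ⟨b3⟩ := nonempty_pi_zmod_addEquiv_of_gcd (t := ![k, f, b, b, m, j, g])
    (t' := ![k, f, n, b, o, j, g]) 2 4 (by decide) hb
    (by simp [Fin.forall_fin_succ]) hg3 hl3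
  obtain ⟨b4⟩ := nonempty_pi_zmod_addEquiv_of_gcd (t := ![k, f, n, b, o, j, g])
    (t' := ![k, f, n, b, p, j, q]) 4 6 (by decide) ho
    (by simp [Fin.forall_fin_succ]) hg4 hl4
  obtain ⟨b5⟩ := nonempty_pi_zmod_addEquiv_of_gcd (t := ![k, f, n, b, p, j, q])
    (t' := ![k, i, n, b, r, j, q]) 1 4 (by decide) hf
    (by simp [Fin.forall_fin_succ]) hg5 hl5
  exact ⟨((((b0.trans b1).trans b2).trans b3).trans b4).trans b5⟩

theorem hasInvariantFactors_of_odd_half {A : Type*} [AddCommGroup A] {s e f : ℕ} (hs : Odd s)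
    (he : Odd e) (hf : Odd f) (h3f : f.factorization 3 = 0)
    (hse : s.factorization 3 ≤ e.factorization 3)
    (hA : Nonempty (A ≃+ ((i : Fin 7) → ZMod (![e, e, 12 * e, 12 * e, s, f, 16 * f] i)))) :
    gcd3 s e f ∣ s.gcd e * e.gcd f ∧
    s.gcd e * e.gcd f ∣ 4 * e * gcd3 (s * e) (s * f) (e * f) ∧
    e.gcd f ∣ 12 * e * f ∧
    gcd3 (s * e) (s * f) (e * f) ∣ 48 * s * e * f ∧
    HasInvariantFactors A
      ![gcd3 s e f,
        e.gcd f,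
        (s.gcd e * e.gcd f) / gcd3 s e f,
        e,
        (4 * e * gcd3 (s * e) (s * f) (e * f)) / (s.gcd e * e.gcd f),
        (12 * e * f) / e.gcd f,
        (48 * s * e * f) / gcd3 (s * e) (s * f) (e * f)] := by
  have h1 : s ≠ 0 := hs.pos.ne'
  have h2 : e ≠ 0 := he.pos.ne'
  have h3 : f ≠ 0 := hf.pos.ne'
  have c4 := Nat.factorization_two_pow_mul_three_pow 2 0
  have c12 := Nat.factorization_two_pow_mul_three_pow 2 1
  have c16 := Nat.factorization_two_pow_mul_three_pow 4 0
  have c48 := Nat.factorization_two_pow_mul_three_pow 4 1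
  norm_num only at c4 c12 c16 c48
  have key : ∀ p, (p = 2 → s.factorization p = 0 ∧ e.factorization p = 0 ∧
      f.factorization p = 0) ∧
      (p = 3 → f.factorization p = 0 ∧ s.factorization p ≤ e.factorization p) := by
    refine fun p => ⟨?_, ?_⟩
    · rintro rfl
      exact ⟨Nat.factorization_eq_zero_of_not_dvd hs.not_two_dvd_nat,
        Nat.factorization_eq_zero_of_not_dvd he.not_two_dvd_nat,
        Nat.factorization_eq_zero_of_not_dvd hf.not_two_dvd_nat⟩
    · rintro rfl
      exact ⟨h3f, hse⟩
  obtain ⟨g0, l0, g1, l1, g2, l2, g3, l3, g4, l4, g5, l5, d0, d1, d2, d3⟩ :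
      (12 * e).gcd (16 * f) = 4 * e.gcd f ∧
      (4 * e.gcd f) * (48 * e.lcm f) = (12 * e) * (16 * f) ∧
      (12 * e).gcd (f) = e.gcd f ∧
      (e.gcd f) * (12 * e.lcm f) = (12 * e) * (f) ∧
      (e.gcd f).gcd (s) = gcd3 s e f ∧
      (gcd3 s e f) * (s.lcm (e.gcd f)) = (e.gcd f) * (s) ∧
      (e).gcd (s.lcm (e.gcd f)) = (s.gcd e).lcm (e.gcd f) ∧
      ((s.gcd e).lcm (e.gcd f)) * (s.lcm e) = (e) * (s.lcm (e.gcd f)) ∧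
      (s.lcm e).gcd (48 * e.lcm f) = (s.lcm e).gcd (e.lcm f) ∧
      ((s.lcm e).gcd (e.lcm f)) * (48 * s.lcm (e.lcm f)) = (s.lcm e) * (48 * e.lcm f) ∧
      (4 * e.gcd f).gcd ((s.lcm e).gcd (e.lcm f)) = e.gcd f ∧
      (e.gcd f) * (4 * (s.lcm e).gcd (e.lcm f)) = (4 * e.gcd f) * ((s.lcm e).gcd (e.lcm f)) ∧
      s.gcd e * e.gcd f = ((s.gcd e).lcm (e.gcd f)) * (gcd3 s e f) ∧
      4 * e * gcd3 (s * e) (s * f) (e * f) = (4 * (s.lcm e).gcd (e.lcm f)) * (s.gcd e * e.gcd f) ∧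
      12 * e * f = (12 * e.lcm f) * (e.gcd f) ∧
      48 * s * e * f = (48 * s.lcm (e.lcm f)) * (gcd3 (s * e) (s * f) (e * f)) := by
    refine ⟨?_, ?_, ?_, ?_, ?_, ?_, ?_, ?_, ?_, ?_, ?_, ?_, ?_, ?_, ?_, ?_⟩ <;>
    · refine Nat.eq_of_factorization_eq (by simp [gcd3, h1, h2, h3]) (by simp [gcd3, h1, h2, h3])
        fun p => ?_
      have q := Nat.factorization_two_three p
      have hp := key p
      simp only [gcd3, Nat.factorization_mul_apply, Nat.factorization_gcd_apply,
        Nat.factorization_lcm_apply, ne_eq, mul_eq_zero, Nat.gcd_eq_zero_iff, Nat.lcm_eq_zero_iff,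
        OfNat.ofNat_ne_zero, or_self, and_self, not_false_eq_true, h1, h2, h3, c4, c12, c16, c48]
      all_goals omega
  obtain ⟨a0, a1, a2, a3, a4, a5⟩ :
      gcd3 s e f ∣ e.gcd f ∧
      e.gcd f ∣ (s.gcd e).lcm (e.gcd f) ∧
      (s.gcd e).lcm (e.gcd f) ∣ e ∧
      e ∣ 4 * (s.lcm e).gcd (e.lcm f) ∧
      4 * (s.lcm e).gcd (e.lcm f) ∣ 12 * e.lcm f ∧
      12 * e.lcm f ∣ 48 * s.lcm (e.lcm f) := by
    refine ⟨?_, ?_, ?_, ?_, ?_, ?_⟩ <;>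
    · refine (Nat.factorization_le_iff_dvd (by simp [gcd3, h1, h2, h3]) (by simp [gcd3, h1, h2,
        h3])).1 fun p => ?_
      have q := Nat.factorization_two_three p
      have hp := key p
      simp only [gcd3, Nat.factorization_mul_apply, Nat.factorization_gcd_apply,
        Nat.factorization_lcm_apply, ne_eq, mul_eq_zero, Nat.gcd_eq_zero_iff, Nat.lcm_eq_zero_iff,
        OfNat.ofNat_ne_zero, or_self, and_self, not_false_eq_true, h1, h2, h3, c4, c12, c16, c48]
      all_goals omega
  refine ⟨⟨_, d0.trans (mul_comm _ _)⟩, ⟨_, d1.trans (mul_comm _ _)⟩, ⟨_, d2.trans (mul_comm _ _)⟩,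
      ⟨_, d3.trans (mul_comm _ _)⟩, ?_⟩
  rw [Nat.div_eq_of_eq_mul_left (Nat.pos_of_ne_zero (by simp [gcd3, h1, h2, h3])) d0,
      Nat.div_eq_of_eq_mul_left (Nat.pos_of_ne_zero (by simp [gcd3, h1, h2, h3])) d1,
      Nat.div_eq_of_eq_mul_left (Nat.pos_of_ne_zero (by simp [gcd3, h1, h2, h3])) d2,
      Nat.div_eq_of_eq_mul_left (Nat.pos_of_ne_zero (by simp [gcd3, h1, h2, h3])) d3]
  obtain ⟨b⟩ := hA
  obtain ⟨b'⟩ := nonempty_pi_zmod_addEquiv_swap_pairs (e) (e) (12 * e) (12 * e) (s) (f) (16 * f)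
  obtain ⟨c⟩ := nonempty_pi_zmod_addEquiv_of_odd_half (Nat.pos_of_ne_zero (by simp [gcd3, h1, h2,
      h3])) (Nat.pos_of_ne_zero (by simp [gcd3, h1, h2, h3])) (Nat.pos_of_ne_zero (by simp [gcd3,
      h1, h2, h3])) (Nat.pos_of_ne_zero (by simp [gcd3, h1, h2, h3])) (Nat.pos_of_ne_zero (by simp
      [gcd3, h1, h2, h3])) g0 l0 g1 l1 g2 l2 g3 l3 g4 l4 g5 l5
  exact hasInvariantFactors_seven (by simp [gcd3, h1, h2, h3]) (by simp [gcd3, h1, h2, h3]) a0 a1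
      a2 a3 a4 a5 ⟨(b.trans b').trans c⟩

theorem nonempty_pi_zmod_addEquiv_of_even_half {a b c d e f g i j k m n o p q : ℕ}
    (hb : 0 < b) (ha : 0 < a) (hi : 0 < i) (ho : 0 < o)
    (hg0 : b.gcd d = f) (hl0 : f * g = b * d)
    (hg1 : a.gcd e = i) (hl1 : i * j = a * e)
    (hg2 : i.gcd c = k) (hl2 : k * m = i * c)
    (hg3 : b.gcd m = n) (hl3 : n * o = b * m)
    (hg4 : o.gcd j = p) (hl4 : p * q = o * j) :
    Nonempty (((l : Fin 7) → ZMod (![a, b, b, a, c, d, e] l)) ≃+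
      ((l : Fin 7) → ZMod (![k, f, n, a, p, g, q] l))) := by
  obtain ⟨b0⟩ := nonempty_pi_zmod_addEquiv_of_gcd (t := ![a, b, b, a, c, d, e])
    (t' := ![a, f, b, a, c, g, e]) 1 5 (by decide) hb
    (by simp [Fin.forall_fin_succ]) hg0 hl0
  obtain ⟨b1⟩ := nonempty_pi_zmod_addEquiv_of_gcd (t := ![a, f, b, a, c, g, e])
    (t' := ![i, f, b, a, c, g, j]) 0 6 (by decide) ha
    (by simp [Fin.forall_fin_succ]) hg1 hl1
  obtain ⟨b2⟩ := nonempty_pi_zmod_addEquiv_of_gcd (t := ![i, f, b, a, c, g, j])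
    (t' := ![k, f, b, a, m, g, j]) 0 4 (by decide) hi
    (by simp [Fin.forall_fin_succ]) hg2 hl2
  obtain ⟨b3⟩ := nonempty_pi_zmod_addEquiv_of_gcd (t := ![k, f, b, a, m, g, j])
    (t' := ![k, f, n, a, o, g, j]) 2 4 (by decide) hb
    (by simp [Fin.forall_fin_succ]) hg3 hl3
  obtain ⟨b4⟩ := nonempty_pi_zmod_addEquiv_of_gcd (t := ![k, f, n, a, o, g, j])
    (t' := ![k, f, n, a, p, g, q]) 4 6 (by decide) ho
    (by simp [Fin.forall_fin_succ]) hg4 hl4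
  exact ⟨(((b0.trans b1).trans b2).trans b3).trans b4⟩

/-- The strict inequality at 3 and the exact valuations at 2 give `gcd(6e, 16f) = 12 gcd(e, f)`; as
`s` has no more 2s or 3s than `gcd(e, f)`, the 12 then passes entirely to the lcm with `s`. -/
theorem hasInvariantFactors_of_even_half {A : Type*} [AddCommGroup A] {s e f : ℕ} (h1 : s ≠ 0)
    (h2 : e ≠ 0) (h3 : f ≠ 0) (hsf : s.factorization 2 = f.factorization 2)
    (hef : e.factorization 2 = f.factorization 2 + 1)
    (h3s : s.factorization 3 ≤ e.factorization 3) (h3f : e.factorization 3 < f.factorization 3)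
    (hA : Nonempty (A ≃+ ((i : Fin 7) → ZMod (![2 * e, 2 * e, 6 * e, 6 * e, s, f, 16 * f] i)))) :
    gcd3 s e f ∣ 4 * (s.gcd e * e.gcd f) ∧
    s.gcd e * e.gcd f ∣ 6 * e * gcd3 (s * e) (s * f) (e * f) ∧
    e.gcd f ∣ 2 * e * f ∧
    gcd3 (s * e) (s * f) (e * f) ∣ 8 * s * e * f ∧
    HasInvariantFactors A
      ![gcd3 s e f,
        e.gcd f,
        (4 * (s.gcd e * e.gcd f)) / gcd3 s e f,
        6 * e,
        (6 * e * gcd3 (s * e) (s * f) (e * f)) / (s.gcd e * e.gcd f),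
        (2 * e * f) / e.gcd f,
        (8 * s * e * f) / gcd3 (s * e) (s * f) (e * f)] := by
  have c4 := Nat.factorization_two_pow_mul_three_pow 2 0
  have c6 := Nat.factorization_two_pow_mul_three_pow 1 1
  have c8 := Nat.factorization_two_pow_mul_three_pow 3 0
  have c12 := Nat.factorization_two_pow_mul_three_pow 2 1
  have c16 := Nat.factorization_two_pow_mul_three_pow 4 0
  norm_num only at c4 c6 c8 c12 c16
  have key : ∀ p, (p = 2 → s.factorization p = f.factorization p ∧
      e.factorization p = f.factorization p + 1) ∧
      (p = 3 → s.factorization p ≤ e.factorization p ∧ e.factorization p < f.factorization p) := by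
    refine fun p => ⟨?_, ?_⟩ <;> rintro rfl
    exacts [⟨hsf, hef⟩, ⟨h3s, h3f⟩]
  obtain ⟨g0, l0, g1, l1, g2, l2, g3, l3, g4, l4, d0, d1, d2, d3⟩ :
      (2 * e).gcd (f) = e.gcd f ∧
      (e.gcd f) * (2 * e.lcm f) = (2 * e) * (f) ∧
      (6 * e).gcd (16 * f) = 12 * e.gcd f ∧
      (12 * e.gcd f) * (8 * e.lcm f) = (6 * e) * (16 * f) ∧
      (12 * e.gcd f).gcd (s) = gcd3 s e f ∧
      (gcd3 s e f) * (12 * s.lcm (e.gcd f)) = (12 * e.gcd f) * (s) ∧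
      (2 * e).gcd (12 * s.lcm (e.gcd f)) = 4 * (s.gcd e).lcm (e.gcd f) ∧
      (4 * (s.gcd e).lcm (e.gcd f)) * (6 * s.lcm e) = (2 * e) * (12 * s.lcm (e.gcd f)) ∧
      (6 * s.lcm e).gcd (8 * e.lcm f) = 6 * (s.lcm e).gcd (e.lcm f) ∧
      (6 * (s.lcm e).gcd (e.lcm f)) * (8 * s.lcm (e.lcm f)) = (6 * s.lcm e) * (8 * e.lcm f) ∧
      4 * (s.gcd e * e.gcd f) = (4 * (s.gcd e).lcm (e.gcd f)) * (gcd3 s e f) ∧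
      6 * e * gcd3 (s * e) (s * f) (e * f) = (6 * (s.lcm e).gcd (e.lcm f)) * (s.gcd e * e.gcd f) ∧
      2 * e * f = (2 * e.lcm f) * (e.gcd f) ∧
      8 * s * e * f = (8 * s.lcm (e.lcm f)) * (gcd3 (s * e) (s * f) (e * f)) := by
    refine ⟨?_, ?_, ?_, ?_, ?_, ?_, ?_, ?_, ?_, ?_, ?_, ?_, ?_, ?_⟩ <;>
    · refine Nat.eq_of_factorization_eq (by simp [gcd3, h1, h2, h3]) (by simp [gcd3, h1, h2, h3])
        fun p => ?_
      have q := Nat.factorization_two_three p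
      have hp := key p
      simp only [gcd3, Nat.factorization_mul_apply, Nat.factorization_gcd_apply,
        Nat.factorization_lcm_apply, ne_eq, mul_eq_zero, Nat.gcd_eq_zero_iff, Nat.lcm_eq_zero_iff,
        OfNat.ofNat_ne_zero, or_self, and_self, not_false_eq_true, h1, h2, h3, c4, c6, c8, c12, c16]
      all_goals omega
  obtain ⟨a0, a1, a2, a3, a4, a5⟩ :
      gcd3 s e f ∣ e.gcd f ∧
      e.gcd f ∣ 4 * (s.gcd e).lcm (e.gcd f) ∧
      4 * (s.gcd e).lcm (e.gcd f) ∣ 6 * e ∧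
      6 * e ∣ 6 * (s.lcm e).gcd (e.lcm f) ∧
      6 * (s.lcm e).gcd (e.lcm f) ∣ 2 * e.lcm f ∧
      2 * e.lcm f ∣ 8 * s.lcm (e.lcm f) := by
    refine ⟨?_, ?_, ?_, ?_, ?_, ?_⟩ <;>
    · refine (Nat.factorization_le_iff_dvd (by simp [gcd3, h1, h2, h3]) (by simp [gcd3, h1, h2,
        h3])).1 fun p => ?_
      have q := Nat.factorization_two_three p
      have hp := key p
      simp only [gcd3, Nat.factorization_mul_apply, Nat.factorization_gcd_apply,
        Nat.factorization_lcm_apply, ne_eq, mul_eq_zero, Nat.gcd_eq_zero_iff, Nat.lcm_eq_zero_iff,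
        OfNat.ofNat_ne_zero, or_self, and_self, not_false_eq_true, h1, h2, h3, c4, c6, c8, c12, c16]
      all_goals omega
  refine ⟨⟨_, d0.trans (mul_comm _ _)⟩, ⟨_, d1.trans (mul_comm _ _)⟩, ⟨_, d2.trans (mul_comm _ _)⟩,
      ⟨_, d3.trans (mul_comm _ _)⟩, ?_⟩
  rw [Nat.div_eq_of_eq_mul_left (Nat.pos_of_ne_zero (by simp [gcd3, h1, h2, h3])) d0,
      Nat.div_eq_of_eq_mul_left (Nat.pos_of_ne_zero (by simp [gcd3, h1, h2, h3])) d1,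
      Nat.div_eq_of_eq_mul_left (Nat.pos_of_ne_zero (by simp [gcd3, h1, h2, h3])) d2,
      Nat.div_eq_of_eq_mul_left (Nat.pos_of_ne_zero (by simp [gcd3, h1, h2, h3])) d3]
  obtain ⟨b⟩ := hA
  obtain ⟨b'⟩ := nonempty_pi_zmod_addEquiv_swap (2 * e) (2 * e) (6 * e) (6 * e) (s) (f) (16 * f)
  obtain ⟨c⟩ := nonempty_pi_zmod_addEquiv_of_even_half (Nat.pos_of_ne_zero (by simp [gcd3, h1, h2,
      h3])) (Nat.pos_of_ne_zero (by simp [gcd3, h1, h2, h3])) (Nat.pos_of_ne_zero (by simp [gcd3,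
      h1, h2, h3])) (Nat.pos_of_ne_zero (by simp [gcd3, h1, h2, h3])) g0 l0 g1 l1 g2 l2 g3 l3 g4 l4
  exact hasInvariantFactors_seven (by simp [gcd3, h1, h2, h3]) (by simp [gcd3, h1, h2, h3]) a0 a1
      a2 a3 a4 a5 ⟨(b.trans b').trans c⟩

/-! ### Arithmetic of `e` and `f` at the primes 2 and 3. -/

section Pell

variable {d : ℤ} {z : ℤ√d}

theorem Zsqrtd.re_sq_pow (hz : z.norm = 1) (k : ℕ) :
    (z ^ k).re ^ 2 = 1 + d * (z ^ k).im ^ 2 := by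
  have h : (z ^ k).norm = 1 := by
    have := map_pow Zsqrtd.normMonoidHom z k
    exact this.trans ((congrArg (· ^ k) hz).trans (one_pow k))
  rw [Zsqrtd.norm_def] at h
  linear_combination h

theorem Zsqrtd.im_pow_two_mul (k : ℕ) :
    (z ^ (2 * k)).im = 2 * (z ^ k).re * (z ^ k).im := by
  rw [two_mul, pow_add, Zsqrtd.im_mul]
  ring

theorem Zsqrtd.re_pow_two_mul (hz : z.norm = 1) (k : ℕ) :
    (z ^ (2 * k)).re = 1 + 2 * d * (z ^ k).im ^ 2 := by
  rw [two_mul, pow_add, Zsqrtd.re_mul]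
  linear_combination Zsqrtd.re_sq_pow hz k

theorem Zsqrtd.im_pow_three_mul (hz : z.norm = 1) (k : ℕ) :
    (z ^ (3 * k)).im = (z ^ k).im * (4 * d * (z ^ k).im ^ 2 + 3) := by
  rw [show 3 * k = 2 * k + k by ring, pow_add, Zsqrtd.im_mul, Zsqrtd.im_pow_two_mul,
    Zsqrtd.re_pow_two_mul hz]
  linear_combination 2 * (z ^ k).im * Zsqrtd.re_sq_pow hz k

/-- A unit `z` of norm 1 satisfies `z² = (2 re z) z - 1`, the recurrence of `lucasU`. -/
theorem Zsqrtd.im_pow_eq_lucasU {m : ℕ} (hz : z.norm = 1) (hm : 2 * z.re = m + 2)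
    (him : z.im = 1) (k : ℕ) : (z ^ k).im = lucasU m k := by
  induction k using Nat.twoStepInduction with
  | zero => simp [lucasU]
  | one => simp [lucasU, him]
  | more k ih0 ih1 =>
    rw [Zsqrtd.norm_def, him] at hz
    rw [pow_succ, Zsqrtd.im_mul, him] at ih1
    rw [lucasU_rec, pow_add, Zsqrtd.im_mul, sq, Zsqrtd.im_mul, Zsqrtd.re_mul, him, ← hm, ← ih1,
      ← ih0]
    linear_combination -(z ^ k).im * hz

end Pell

theorem im_pow_eq_eSeq (k : ℕ) : ((⟨2, 1⟩ : ℤ√3) ^ k).im = eSeq k :=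
  Zsqrtd.im_pow_eq_lucasU (by decide) rfl rfl k

/-- The ring is `ℤ√8` rather than `ℤ√2` so that the unit `3 + √8` has imaginary part 1. -/
theorem im_pow_eq_fSeq (k : ℕ) : ((⟨3, 1⟩ : ℤ√8) ^ k).im = fSeq k :=
  Zsqrtd.im_pow_eq_lucasU (by decide) rfl rfl k

theorem lucasU_pos (m : ℕ) {k : ℕ} (hk : 0 < k) : 0 < lucasU m k := by
  induction k, hk using Nat.le_induction with
  | base => exact one_pos
  | succ k _ ih => exact ih.trans_le (lucasU_le_succ m k)

theorem lucasU_mod_two (m : ℕ) (hm : Even m) (k : ℕ) : lucasU m k % 2 = k % 2 := by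
  obtain ⟨c, rfl⟩ := hm
  induction k using Nat.twoStepInduction with
  | zero => rfl
  | one => rfl
  | more k ih0 ih1 =>
    have h := lucasU_rec (c + c) k
    have h' : (lucasU (c + c) (k + 2) : ℤ) =
        2 * ((c + 1) * lucasU (c + c) (k + 1)) - lucasU (c + c) k := by
      rw [h]
      push_cast
      ring
    omega

theorem odd_eSeq {k : ℕ} (hk : Odd k) : Odd (eSeq k) := by
  rw [Nat.odd_iff] at hk ⊢
  rw [eSeq, lucasU_mod_two 2 (by decide), hk]

theorem odd_fSeq {k : ℕ} (hk : Odd k) : Odd (fSeq k) := by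
  rw [Nat.odd_iff] at hk ⊢
  rw [fSeq, lucasU_mod_two 4 (by decide), hk]

theorem odd_hSeq (k : ℕ) : Odd (hSeq k) := by
  have h0 := lucasU_mod_two 2 (by decide) k
  have h1 := lucasU_mod_two 2 (by decide) (k + 1)
  rw [Nat.odd_iff, hSeq, eSeq, eSeq]
  omega

theorem odd_gSeq (k : ℕ) : Odd (gSeq k) := by
  have h0 := lucasU_mod_two 4 (by decide) k
  have h1 := lucasU_mod_two 4 (by decide) (k + 1)
  rw [Nat.odd_iff, gSeq, fSeq, fSeq]
  omega

theorem eSeq_rec (k : ℕ) : (eSeq (k + 2) : ℤ) = 4 * eSeq (k + 1) - eSeq k := by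
  simpa [eSeq, show (2 : ℤ) + 2 = 4 by norm_num] using lucasU_rec 2 k

theorem fSeq_rec (k : ℕ) : (fSeq (k + 2) : ℤ) = 6 * fSeq (k + 1) - fSeq k := by
  simpa [fSeq, show (4 : ℤ) + 2 = 6 by norm_num] using lucasU_rec 4 k

theorem eSeq_mod_three (k : ℕ) : ¬ 3 ∣ eSeq (3 * k + 1) ∧ ¬ 3 ∣ eSeq (3 * k + 2) := by
  suffices h : 3 ∣ eSeq (3 * k) ∧ ¬ 3 ∣ eSeq (3 * k + 1) by
    have := eSeq_rec (3 * k)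
    omega
  induction k with
  | zero => decide
  | succ k ih =>
    have h0 := eSeq_rec (3 * k)
    have h1 := eSeq_rec (3 * k + 1)
    have h2 := eSeq_rec (3 * k + 2)
    rw [show 3 * (k + 1) = 3 * k + 3 by ring]
    simp only [add_assoc, Nat.reduceAdd] at h0 h1 h2 ⊢
    omega

theorem fSeq_mod_three (k : ℕ) : 3 ∣ fSeq (2 * k) ∧ ¬ 3 ∣ fSeq (2 * k + 1) := by
  induction k with
  | zero => decide
  | succ k ih =>
    have h0 := fSeq_rec (2 * k)
    have h1 := fSeq_rec (2 * k + 1)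
    rw [show 2 * (k + 1) = 2 * k + 2 by ring]
    simp only [add_assoc, Nat.reduceAdd] at h0 h1 ⊢
    omega

theorem eSeq_three_mul (k : ℕ) : eSeq (3 * k) = 3 * (eSeq k * (4 * eSeq k ^ 2 + 1)) := by
  have h := Zsqrtd.im_pow_three_mul (z := (⟨2, 1⟩ : ℤ√3)) (by decide) k
  rw [im_pow_eq_eSeq, im_pow_eq_eSeq] at h
  zify
  rw [h]
  ring

theorem fSeq_three_mul (k : ℕ) : fSeq (3 * k) = fSeq k * (32 * fSeq k ^ 2 + 3) := by
  have h := Zsqrtd.im_pow_three_mul (z := (⟨3, 1⟩ : ℤ√8)) (by decide) k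
  rw [im_pow_eq_fSeq, im_pow_eq_fSeq] at h
  zify
  rw [h]
  ring

/-- Tripling the index adds exactly one factor 3: `e₃ₖ = 3 eₖ (4eₖ² + 1)`, and `-1` is not a square
modulo 3. -/
theorem factorization_eSeq_three {k : ℕ} (hk : 0 < k) :
    (eSeq k).factorization 3 = k.factorization 3 := by
  induction k using Nat.strong_induction_on with
  | _ k ih =>
    by_cases h : 3 ∣ k
    · obtain ⟨t, rfl⟩ := h
      have ht : 0 < t := by omega
      have he : eSeq t ≠ 0 := (lucasU_pos 2 ht).ne'
      have h1 : (4 * eSeq t ^ 2 + 1).factorization 3 = 0 := by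
        refine Nat.factorization_eq_zero_of_not_dvd fun h => ?_
        have := Nat.mod_lt (eSeq t) (show 3 > 0 by norm_num)
        rw [Nat.dvd_iff_mod_eq_zero, Nat.add_mod, Nat.mul_mod, Nat.pow_mod] at h
        interval_cases eSeq t % 3 <;> simp at h
      rw [eSeq_three_mul, Nat.factorization_mul_apply (by norm_num) (by positivity),
        Nat.factorization_mul_apply he (by positivity), h1, ih t (by omega) ht,
        Nat.factorization_mul_apply (by norm_num) ht.ne', add_zero]
    · have h3 : ¬ 3 ∣ eSeq k := by
        obtain h' | h' : k % 3 = 1 ∨ k % 3 = 2 := by omega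
        · rw [← Nat.div_add_mod k 3, h']
          exact (eSeq_mod_three _).1
        · rw [← Nat.div_add_mod k 3, h']
          exact (eSeq_mod_three _).2
      rw [Nat.factorization_eq_zero_of_not_dvd h, Nat.factorization_eq_zero_of_not_dvd h3]

/-- For even `k`, 3 divides `fₖ`, so the cofactor `32 fₖ² + 3` of `f₃ₖ` brings at least one more 3,
while `k` gains exactly one. -/
theorem factorization_lt_factorization_fSeq_three {k : ℕ} (hk : 0 < k) (hk2 : Even k) :
    k.factorization 3 < (fSeq k).factorization 3 := by
  induction k using Nat.strong_induction_on with
  | _ k ih =>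
    have pos {k : ℕ} (hk : 0 < k) (hk2 : Even k) : 0 < (fSeq k).factorization 3 := by
      obtain ⟨t, rfl⟩ := hk2
      refine Nat.prime_three.factorization_pos_of_dvd (lucasU_pos 4 hk).ne' ?_
      rw [← two_mul]
      exact (fSeq_mod_three t).1
    by_cases h : 3 ∣ k
    · obtain ⟨t, rfl⟩ := h
      have ht : 0 < t := by omega
      have ht2 : Even t := by
        rw [Nat.even_iff] at hk2 ⊢
        omega
      have hf : fSeq t ≠ 0 := (lucasU_pos 4 ht).ne'
      have h1 : 0 < (32 * fSeq t ^ 2 + 3).factorization 3 := by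
        refine Nat.prime_three.factorization_pos_of_dvd (by positivity) ?_
        refine dvd_add (dvd_mul_of_dvd_right (dvd_pow ?_ two_ne_zero) _) dvd_rfl
        exact Nat.dvd_of_factorization_pos (pos ht ht2).ne'
      have := ih t (by omega) ht ht2
      rw [fSeq_three_mul, Nat.factorization_mul_apply hf (by positivity),
        Nat.factorization_mul_apply (by norm_num) ht.ne',
        Nat.prime_three.factorization_self]
      omega
    · rw [Nat.factorization_eq_zero_of_not_dvd h]
      exact pos hk hk2

theorem eSeq_fSeq_mod_eight (r : ℕ) :
    eSeq (4 * r + 2) % 8 = 4 ∧ (fSeq (4 * r + 2) + (4 * r + 2)) % 8 = 0 := by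
  suffices h : (eSeq (4 * r + 2) % 8 = 4 ∧ eSeq (4 * r + 3) % 8 = 7) ∧
      (fSeq (4 * r + 2) + (4 * r + 2)) % 8 = 0 ∧ (fSeq (4 * r + 3)) % 8 = (3 + 4 * r) % 8 from
    ⟨h.1.1, h.2.1⟩
  induction r with
  | zero => decide
  | succ r ih =>
    have h0 := eSeq_rec (4 * r + 2)
    have h1 := eSeq_rec (4 * r + 3)
    have h2 := eSeq_rec (4 * r + 4)
    have h3 := eSeq_rec (4 * r + 5)
    have k0 := fSeq_rec (4 * r + 2)
    have k1 := fSeq_rec (4 * r + 3)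
    have k2 := fSeq_rec (4 * r + 4)
    have k3 := fSeq_rec (4 * r + 5)
    rw [show 4 * (r + 1) = 4 * r + 4 by ring]
    simp only [add_assoc, Nat.reduceAdd] at h0 h1 h2 h3 k0 k1 k2 k3 ih ⊢
    omega

/-- The common power of `2` in `s`, `eₛ` and `fₛ` for even `s`. -/
theorem exists_eSeq_fSeq_of_even {s : ℕ} (hs : 0 < s) (hs2 : Even s) :
    ∃ d j p q : ℤ, (eSeq s : ℤ) = d * (4 * (2 * j + 1)) ∧ (s : ℤ) = 2 * d * (1 + 2 * p + 2 * q) ∧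
      (fSeq s : ℤ) = 2 * d * (2 * p - 2 * q - 1) := by
  induction s using Nat.strong_induction_on with
  | _ s ih =>
    by_cases h : s % 4 = 2
    · obtain ⟨r, rfl⟩ : ∃ r, s = 4 * r + 2 := ⟨s / 4, by omega⟩
      obtain ⟨he, hf⟩ := eSeq_fSeq_mod_eight r
      obtain ⟨j, hj⟩ : ∃ j : ℤ, (eSeq (4 * r + 2) : ℤ) = 4 + 8 * j :=
        ⟨(eSeq (4 * r + 2) : ℤ) / 8, by omega⟩
      obtain ⟨l, hl⟩ : ∃ l : ℤ, (fSeq (4 * r + 2) : ℤ) = -(4 * r + 2) + 8 * l :=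
        ⟨((fSeq (4 * r + 2) : ℤ) + (4 * r + 2)) / 8, by omega⟩
      -- The three forms require `s + fₛ = 8 d p`; for `s ≡ 2` modulo 4 and `d = 1` this is the
      -- congruence modulo 8.
      refine ⟨1, j, l, r - l, ?_, ?_, ?_⟩
      · rw [hj]
        ring
      · push_cast
        ring
      · rw [hl]
        ring
    · obtain ⟨s, rfl⟩ : ∃ t, s = 2 * t := hs2.two_dvd
      have hs' : Even s := by
        rw [Nat.even_iff]
        omega
      obtain ⟨d, j, p, q, he, hsd, hf⟩ := ih s (by omega) (by omega) hs'
      -- Halving once more writes the real parts in the duplication formula as `1 + 6 eₖ²` and `1 +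
      -- 16 fₖ²`: odd, and for `f` even 1 modulo 4.
      obtain ⟨k, rfl⟩ : ∃ t, s = 2 * t := hs'.two_dvd
      have e1 := Zsqrtd.im_pow_two_mul (z := (⟨2, 1⟩ : ℤ√3)) (2 * k)
      have f1 := Zsqrtd.im_pow_two_mul (z := (⟨3, 1⟩ : ℤ√8)) (2 * k)
      rw [Zsqrtd.re_pow_two_mul (by decide), im_pow_eq_eSeq, im_pow_eq_eSeq, im_pow_eq_eSeq,
        he] at e1
      rw [Zsqrtd.re_pow_two_mul (by decide), im_pow_eq_fSeq, im_pow_eq_fSeq, im_pow_eq_fSeq,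
        hf] at f1
      set t : ℤ := 3 * (eSeq k : ℤ) ^ 2 with ht
      set w : ℤ := 4 * (fSeq k : ℤ) ^ 2 with hw
      -- These solve `2j' + 1 = (2j + 1)(1 + 2t)`, `p' + q' = p + q` and `2p' - 2q' - 1 = (2p - 2q -
      -- 1)(1 + 4w)`.
      refine ⟨2 * d, j + t + 2 * j * t, p + w * (2 * p - 2 * q - 1),
        q - w * (2 * p - 2 * q - 1), ?_, ?_, ?_⟩
      · rw [e1, ht]
        ring
      · push_cast at hsd ⊢
        linear_combination 2 * hsd
      · rw [f1, hw]
        ring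

theorem factorization_two_of_eq_mul_odd {x : ℕ} {d o : ℤ} (hx : x ≠ 0) (ho : Odd o)
    (h : (x : ℤ) = d * o) : x.factorization 2 = d.natAbs.factorization 2 := by
  have h' : x = d.natAbs * o.natAbs := by
    rw [← Int.natAbs_mul, ← h, Int.natAbs_natCast]
  have hd : d.natAbs ≠ 0 := fun h0 => hx (by rw [h', h0, zero_mul])
  have h0 : o.natAbs ≠ 0 := fun h0 => hx (by rw [h', h0, mul_zero])
  rw [h', Nat.factorization_mul_apply hd h0,
    Nat.factorization_eq_zero_of_not_dvd (n := o.natAbs) (p := 2)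
      (Int.natAbs_odd.2 ho).not_two_dvd_nat, add_zero]

theorem theorem5p1 (n : ℕ) (hn : 3 ≤ n) :
    -- the case of odd `n = 2s + 1`
    (∀ s : ℕ, n = 2 * s + 1 → ∀ h g : ℕ, h = hSeq s → g = gSeq s →
      -- all the fractions below are exact
      gcd3 n h g ∣ n.gcd h * h.gcd g ∧
      n.gcd h * h.gcd g ∣ h * gcd3 (n * h) (n * g) (h * g) ∧
      h.gcd g ∣ h * g ∧
      gcd3 (n * h) (n * g) (h * g) ∣ 4 * n * h * g ∧
      HasInvariantFactors
        (CriticalGroup (SimpleGraph.boxProd (SimpleGraph.cycleGraph 4) (SimpleGraph.cycleGraph n)))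
        ![gcd3 n h g,
          h.gcd g,
          (n.gcd h * h.gcd g) / gcd3 n h g,
          h,
          (h * gcd3 (n * h) (n * g) (h * g)) / (n.gcd h * h.gcd g),
          (h * g) / h.gcd g,
          (4 * n * h * g) / gcd3 (n * h) (n * g) (h * g)]) ∧
    -- the case `n = 2s` with `s` odd
    (∀ s : ℕ, n = 2 * s → Odd s → ∀ e f : ℕ, e = eSeq s → f = fSeq s →
      gcd3 s e f ∣ s.gcd e * e.gcd f ∧
      s.gcd e * e.gcd f ∣ 4 * e * gcd3 (s * e) (s * f) (e * f) ∧
      e.gcd f ∣ 12 * e * f ∧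
      gcd3 (s * e) (s * f) (e * f) ∣ 48 * s * e * f ∧
      HasInvariantFactors
        (CriticalGroup (SimpleGraph.boxProd (SimpleGraph.cycleGraph 4) (SimpleGraph.cycleGraph n)))
        ![gcd3 s e f,
          e.gcd f,
          (s.gcd e * e.gcd f) / gcd3 s e f,
          e,
          (4 * e * gcd3 (s * e) (s * f) (e * f)) / (s.gcd e * e.gcd f),
          (12 * e * f) / e.gcd f,
          (48 * s * e * f) / gcd3 (s * e) (s * f) (e * f)]) ∧
    -- the case `n = 2s` with `s` even
    (∀ s : ℕ, n = 2 * s → Even s → ∀ e f : ℕ, e = eSeq s → f = fSeq s →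
      gcd3 s e f ∣ 4 * (s.gcd e * e.gcd f) ∧
      s.gcd e * e.gcd f ∣ 6 * e * gcd3 (s * e) (s * f) (e * f) ∧
      e.gcd f ∣ 2 * e * f ∧
      gcd3 (s * e) (s * f) (e * f) ∣ 8 * s * e * f ∧
      HasInvariantFactors
        (CriticalGroup (SimpleGraph.boxProd (SimpleGraph.cycleGraph 4) (SimpleGraph.cycleGraph n)))
        ![gcd3 s e f,
          e.gcd f,
          (4 * (s.gcd e * e.gcd f)) / gcd3 s e f,
          6 * e,
          (6 * e * gcd3 (s * e) (s * f) (e * f)) / (s.gcd e * e.gcd f),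
          (2 * e * f) / e.gcd f,
          (8 * s * e * f) / gcd3 (s * e) (s * f) (e * f)]) := by
  refine ⟨?_, ?_, ?_⟩
  · rintro s hs h g rfl rfl
    exact hasInvariantFactors_of_odd ⟨s, hs⟩ (odd_hSeq s) (odd_gSeq s)
      (nonempty_criticalGroup_addEquiv_of_odd hn hs (odd_hSeq s) (odd_gSeq s))
  · rintro s hs hso e f rfl rfl
    have h3 : (fSeq s).factorization 3 = 0 := by
      obtain ⟨t, rfl⟩ := hso
      exact Nat.factorization_eq_zero_of_not_dvd (fSeq_mod_three t).2
    exact hasInvariantFactors_of_odd_half hso (odd_eSeq hso) (odd_fSeq hso) h3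
      (factorization_eSeq_three hso.pos).ge
      (nonempty_criticalGroup_addEquiv_of_odd_half hn hs (odd_eSeq hso) (odd_fSeq hso))
  · rintro s hs hse e f rfl rfl
    have h0 : 0 < s := by omega
    have he : 0 < eSeq s := lucasU_pos 2 h0
    have hf : 0 < fSeq s := lucasU_pos 4 h0
    obtain ⟨d, j, p, q, hed, hsd, hfd⟩ := exists_eSeq_fSeq_of_even h0 hse
    have hd : d.natAbs ≠ 0 := by
      rw [Int.natAbs_ne_zero]
      rintro rfl
      simp at hsd
      omega
    have v4 := Nat.factorization_two_pow_mul_three_pow 2 0 2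
    have v2 := Nat.prime_two.factorization_self
    have ve := factorization_two_of_eq_mul_odd (d := d * 4) (o := 2 * j + 1) he.ne' ⟨j, rfl⟩
      (by rw [hed]; ring)
    have vs := factorization_two_of_eq_mul_odd h0.ne' ⟨p + q, by ring⟩ hsd
    have vf := factorization_two_of_eq_mul_odd hf.ne' ⟨p - q - 1, by ring⟩ hfd
    rw [Int.natAbs_mul, Nat.factorization_mul_apply hd (by decide)] at ve
    rw [Int.natAbs_mul, Nat.factorization_mul_apply (by decide) hd] at vs vf
    rw [show (4 : ℤ).natAbs = 4 from rfl] at ve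
    rw [show (2 : ℤ).natAbs = 2 from rfl] at vs vf
    norm_num only at v4
    have h3 := factorization_eSeq_three h0
    exact hasInvariantFactors_of_even_half h0.ne' he.ne' hf.ne' (by omega) (by omega) h3.ge
      (h3.trans_lt (factorization_lt_factorization_fSeq_three h0 hse))
      (nonempty_criticalGroup_addEquiv_of_even_half hn hs he hf hed hsd hfd)
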